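/- A \emph{threshold graph} is a finite simple graph with no induced $P_4$, $C_4$ or $2K_2$. Let $G=(V,E)$ be a finite simple graph. A \emph{minimal threshold deletion} of $G$ is a threshold graph $H=(V,E_H)$ with $E_H\subseteq E$ such that there is no threshold graph $(V,E')$ with $E_H\subsetneq E'\subseteq E$. A \emph{minimal threshold completion} of $G$ is a threshold graph $H=(V,E_H)$ with $E\subseteq E_H$ such that there is no threshold graph $(V,E')$ with $E\subseteq E'\subsetneq E_H$. \textbf{Theorem.} The minimal threshold deletions of a graph can be enumerated with polynomial delay and exponential space, and so can the minimal threshold completions. That is, for each of the two problems there are a single (deterministic) program for a random access machine with logarithmic cost and two polynomials $p,q$ such that, for every $n\ge 0$ and every graph $G$ on $n$ labelled vertices given by its adjacency matrix, the program outputs all minimal threshold deletions (respectively, completions) of $G$, each exactly once, and then halts; the time before the first output, the time between any two consecutive outputs and the time between the last output and halting are each at most $p(n)$; and the memory content never takes more than $2^{q(n)}$ bits. -/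

import Mathlib

/-! ### Threshold graphs, minimal deletions and completions -/

/-- `G` is a threshold graph: it has no induced `P₄`, `C₄` or `2K₂`. -/
def IsThreshold {V : Type*} (G : SimpleGraph V) : Prop :=
  ¬ (SimpleGraph.pathGraph 4).IsIndContained G ∧
  ¬ (SimpleGraph.cycleGraph 4).IsIndContained G ∧
  ¬ (SimpleGraph.completeGraph (Fin 2) ⊕g SimpleGraph.completeGraph (Fin 2)).IsIndContained G

/-- The minimal threshold deletions of `G`: the threshold graphs on the vertex set of `G` whose
edge set is contained in that of `G`, inclusion-wise maximal with this property (that is, the set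
of deleted edges is inclusion-wise minimal). -/
def minimalThresholdDeletions {V : Type*} (G : SimpleGraph V) : Set (SimpleGraph V) :=
  {H | Maximal (fun K : SimpleGraph V => K ≤ G ∧ IsThreshold K) H}

/-- The minimal threshold completions of `G`: the threshold graphs on the vertex set of `G` whose
edge set contains that of `G`, inclusion-wise minimal with this property. -/
def minimalThresholdCompletions {V : Type*} (G : SimpleGraph V) : Set (SimpleGraph V) :=
  {H | Minimal (fun K : SimpleGraph V => G ≤ K ∧ IsThreshold K) H}

/-! ### The machine model: a random access machine with logarithmic cost

The memory consists of arrays of natural numbers, with indirect addressing; a program mentions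
only finitely many arrays. (Cell `0` of an array may serve as a scalar register.)
Programs are built from assignments and output instructions by sequencing, branching and loops. -/

namespace RAM

/-- The arithmetic operations (natural subtraction and division; comparisons give `0` or `1`). -/
inductive BinOp
  | add | sub | mul | div | mod | lt | eq

def BinOp.apply : BinOp → ℕ → ℕ → ℕ
  | .add, x, y => x + y
  | .sub, x, y => x - y
  | .mul, x, y => x * y
  | .div, x, y => x / y
  | .mod, x, y => x % y
  | .lt, x, y => if x < y then 1 else 0
  | .eq, x, y => if x = y then 1 else 0

/-- Expressions: `read a e` is the content of cell number `e` of array `a`. -/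
inductive Expr
  | const (k : ℕ)
  | read (a : ℕ) (e : Expr)
  | op (o : BinOp) (e₁ e₂ : Expr)

/-- Programs: `write a e₁ e₂` puts the value of `e₂` into cell number `e₁` of array `a`; `emit e`
outputs the value of `e`; `ite` and `loop` test whether the value of `e` is nonzero. -/
inductive Prog
  | skip
  | write (a : ℕ) (e₁ e₂ : Expr)
  | emit (e : Expr)
  | seq (P Q : Prog)
  | ite (e : Expr) (P Q : Prog)
  | loop (e : Expr) (P : Prog)

/-- Cell `k` of array `a` contains `m a k`. -/
abbrev Memory := ℕ → ℕ → ℕ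

def Expr.eval (m : Memory) : Expr → ℕ
  | .const k => k
  | .read a e => m a (e.eval m)
  | .op o e₁ e₂ => o.apply (e₁.eval m) (e₂.eval m)

/-- The logarithmic cost of an evaluation: every operation and every memory access costs one plus
the number of bits of all numbers involved, addresses included. -/
def Expr.cost (m : Memory) : Expr → ℕ
  | .const k => k.size + 1
  | .read a e => e.cost m + (e.eval m).size + (m a (e.eval m)).size + 1
  | .op o e₁ e₂ => e₁.cost m + e₂.cost m + (e₁.eval m).size + (e₂.eval m).size +
      (o.apply (e₁.eval m) (e₂.eval m)).size + 1

/-- A configuration: what is left to be executed, in this order, and the memory. The length of the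
list never exceeds a bound that depends on the program only. -/
structure Config where
  todo : List Prog
  mem : Memory

/-- One step of the machine; a halted configuration stays as it is. -/
def step : Config → Config
  | ⟨[], m⟩ => ⟨[], m⟩
  | ⟨.skip :: K, m⟩ => ⟨K, m⟩
  | ⟨.write a e₁ e₂ :: K, m⟩ =>
      ⟨K, Function.update m a (Function.update (m a) (e₁.eval m) (e₂.eval m))⟩
  | ⟨.emit _ :: K, m⟩ => ⟨K, m⟩
  | ⟨.seq P Q :: K, m⟩ => ⟨P :: Q :: K, m⟩
  | ⟨.ite e P Q :: K, m⟩ => ⟨(if e.eval m ≠ 0 then P else Q) :: K, m⟩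
  | ⟨.loop e P :: K, m⟩ => ⟨if e.eval m ≠ 0 then P :: .loop e P :: K else K, m⟩

/-- The cost (time) of the next step. -/
def stepCost : Config → ℕ
  | ⟨[], _⟩ => 0
  | ⟨.skip :: _, _⟩ => 1
  | ⟨.write _ e₁ e₂ :: _, m⟩ =>
      e₁.cost m + e₂.cost m + (e₁.eval m).size + (e₂.eval m).size + 1
  | ⟨.emit e :: _, m⟩ => e.cost m + (e.eval m).size + 1
  | ⟨.seq _ _ :: _, _⟩ => 1
  | ⟨.ite e _ _ :: _, m⟩ => e.cost m + 1
  | ⟨.loop e _ :: _, m⟩ => e.cost m + 1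

/-- The number that is output in the next step, if there is one. -/
def stepOutput : Config → Option ℕ
  | ⟨.emit e :: _, m⟩ => some (e.eval m)
  | _ => none

/-- The costs and the outputs of the first `N` steps. -/
def trace : ℕ → Config → List (ℕ × Option ℕ)
  | 0, _ => []
  | N + 1, c => (stepCost c, stepOutput c) :: trace N (step c)

/-- The sequence of all outputs in a trace. -/
def outputs (t : List (ℕ × Option ℕ)) : List ℕ := t.filterMap Prod.snd

/-- The delays in a trace: the time up to the first output, the times between consecutive outputs,
and the time from the last output to the end; `acc` is the time that has already passed since the
last output. -/
def delays : ℕ → List (ℕ × Option ℕ) → List ℕ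
  | acc, [] => [acc]
  | acc, (c, none) :: t => delays (acc + c) t
  | acc, (c, some _) :: t => (acc + c) :: delays 0 t

/-- The memory content fits into `s` bits: outside an initial segment (of length `len a`) of each
of finitely many arrays all cells are zero, and the contents of these initial segments, with one
extra bit per cell, take at most `s` bits altogether. -/
def FitsIn (m : Memory) (s : ℕ) : Prop :=
  ∃ (A : ℕ) (len : ℕ → ℕ),
    (∀ a k, A ≤ a ∨ len a ≤ k → m a k = 0) ∧
    ∑ a ∈ Finset.range A, ∑ k ∈ Finset.range (len a), ((m a k).size + 1) ≤ s

end RAM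

/-! ### Enumeration with polynomial delay and exponential space -/

open Classical in
/-- The input for a graph `G` on `Fin n`: array `0` contains `n` in cell `0`, array `1` contains
the adjacency matrix of `G`, row by row; everything else is zero. -/
noncomputable def graphInput {n : ℕ} (G : SimpleGraph (Fin n)) : RAM.Memory := fun a k =>
  if a = 0 ∧ k = 0 then n
  else if a = 1 ∧ ∃ i j : Fin n, k = n * i + j ∧ G.Adj i j then 1
  else 0

open Classical in
/-- The output for a graph `H` on `Fin n`: the number whose binary digits are the entries of the
adjacency matrix of `H`, the entry `(i, j)` being the digit number `n * i + j`. -/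
noncomputable def graphCode {n : ℕ} (H : SimpleGraph (Fin n)) : ℕ :=
  ∑ e : Fin n × Fin n with H.Adj e.1 e.2, 2 ^ (n * (e.1 : ℕ) + (e.2 : ℕ))

theorem graphCode_injective (n : ℕ) :
    Function.Injective (graphCode : SimpleGraph (Fin n) → ℕ) := by
  classical
  have hinj : Function.Injective (fun e : Fin n × Fin n => n * (e.1 : ℕ) + (e.2 : ℕ)) := by
    intro e f h
    apply (finProdFinEquiv (m := n) (n := n)).injective
    apply Fin.ext
    simp only [finProdFinEquiv_apply_val]
    simp only at h
    omega
  have key : ∀ H : SimpleGraph (Fin n), graphCode H =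
      ∑ k ∈ (Finset.univ.filter (fun e : Fin n × Fin n => H.Adj e.1 e.2)).map ⟨_, hinj⟩,
        2 ^ k := by
    intro H
    rw [Finset.sum_map]
    unfold graphCode
    apply Finset.sum_congr
    · ext e; simp
    · intro e _; rfl
  intro H K h
  rw [key, key] at h
  have h' := Finset.map_injective _ (Finset.geomSum_injective le_rfl h)
  ext i j
  have := congrArg (fun s => (i, j) ∈ s) h'
  simpa using this

/-- The problem of listing, for a given graph `G` on `n` vertices, all graphs in `Sol G`, can be
solved with polynomial delay and exponential space: a single program lists, for every `n` and `G`,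
all elements of `Sol G`, each exactly once, and then halts; every delay is at most `p n`, and at
all times the memory content fits into `2 ^ q n` bits, for polynomials `p` and `q`. -/
def EnumerableWithPolyDelayExpSpace
    (Sol : ∀ {n : ℕ}, SimpleGraph (Fin n) → Set (SimpleGraph (Fin n))) : Prop :=
  ∃ (P : RAM.Prog) (p q : Polynomial ℕ), ∀ (n : ℕ) (G : SimpleGraph (Fin n)),
    ∃ (N : ℕ) (L : List (SimpleGraph (Fin n))),
      (RAM.step^[N] ⟨[P], graphInput G⟩).todo = [] ∧
      RAM.outputs (RAM.trace N ⟨[P], graphInput G⟩) = L.map graphCode ∧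
      L.Nodup ∧
      (∀ H, H ∈ L ↔ H ∈ Sol G) ∧
      (∀ d ∈ RAM.delays 0 (RAM.trace N ⟨[P], graphInput G⟩), d ≤ p.eval n) ∧
      (∀ k ≤ N, RAM.FitsIn (RAM.step^[k] ⟨[P], graphInput G⟩).mem (2 ^ q.eval n))

/-! ### Threshold graphs -/

/-! The solutions are the nodes of an implicit directed graph with at most `n * n` arcs out of each
node. If all nodes can be reached from one start node and the arcs are computable in polynomial
time, a breadth-first search that marks every node found lists them with polynomial delay. The marks
and the queue are what needs exponential space.

Completions reduce to deletions. A graph is threshold iff it has no alternating 4-cycle (edges `ab`,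
`cd`, nonedges `bc`, `da`), a condition symmetric under complementation. Hence the minimal
completions of `G` are the complements of the minimal deletions of `Gᶜ`.

In a threshold graph the neighbourhoods are nested by degree (`IsThreshold.adj_of_ncard_le`). It
follows that between threshold graphs `H < H'` some single edge of `H'` can be added to `H`
(`IsThreshold.exists_sup_edge`). So maximality can be tested edge by edge, and a greedy procedure
extends any threshold subgraph of `G` to a minimal deletion (`greedy_spec`).

The arcs come from pivoting. For a solution `S` and distinct vertices `c`, `x` nonadjacent in `S`,
`pivotGraph G S c x` is a threshold subgraph of `G`, and the corresponding neighbour of `S` is its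
greedy extension. Given another solution `T`, let `c` be a vertex of largest `T`-degree among those
with a `T`-edge missing from `S`, and let `cx` be such a missing edge with `x` of least `S`-degree.
The pivot graph then preserves all `T`-edges at the vertices of `commonPart T S` and gains all
`T`-edges at `c`. Thus every solution above it has a larger common part with `T`
(`exists_pivotGraph_closer`), and a closed nonempty set of solutions contains every solution
(`mem_of_pivotGraph_closed`).

For the machine, everything evaluated per node is written in a small language `LoopExpr` whose loops
run `n` times and whose variables are kept to polynomially many bits. Its compiler is proved
correct, with a time bound that is polynomial for each fixed expression. Graphs are handled as the
numbers coding their adjacency matrices. The space bound follows from the delay bound: a step of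
polynomial cost touches only addresses and contents of polynomially many bits. -/

theorem isIndContained_fin_four {V : Type*} {G : SimpleGraph V} {F : SimpleGraph (Fin 4)}
    (a b c d : V) (nab : a ≠ b) (nac : a ≠ c) (nad : a ≠ d) (nbc : b ≠ c) (nbd : b ≠ d)
    (ncd : c ≠ d) (hab : G.Adj a b ↔ F.Adj 0 1) (hac : G.Adj a c ↔ F.Adj 0 2)
    (had : G.Adj a d ↔ F.Adj 0 3) (hbc : G.Adj b c ↔ F.Adj 1 2) (hbd : G.Adj b d ↔ F.Adj 1 3)
    (hcd : G.Adj c d ↔ F.Adj 2 3) : F.IsIndContained G := by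
  have hinj : Function.Injective ![a, b, c, d] := by
    intro i j
    fin_cases i <;> fin_cases j <;>
      simp [nab, nac, nad, nbc, nbd, ncd, nab.symm, nac.symm, nad.symm, nbc.symm, nbd.symm,
        ncd.symm]
  refine ⟨⟨⟨![a, b, c, d], hinj⟩, ?_⟩⟩
  intro i j
  change G.Adj (![a, b, c, d] i) (![a, b, c, d] j) ↔ F.Adj i j
  fin_cases i <;> fin_cases j <;>
    simp [hab, hac, had, hbc, hbd, hcd, G.adj_comm b a, G.adj_comm c a, G.adj_comm d a,
      G.adj_comm c b, G.adj_comm d b, G.adj_comm d c, F.adj_comm 1 0, F.adj_comm 2 0,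
      F.adj_comm 3 0, F.adj_comm 2 1, F.adj_comm 3 1, F.adj_comm 3 2]

/-- The three forbidden graphs are exactly those on four vertices with an alternating 4-cycle. The
two free pairs `ac` and `bd` decide which one occurs: both edges give `C₄`, one gives `P₄`, none
gives `2K₂`. -/
theorem isThreshold_iff {V : Type*} (G : SimpleGraph V) :
    IsThreshold G ↔ ∀ a b c d, G.Adj a b → ¬ G.Adj b c → G.Adj c d → ¬ G.Adj d a →
      b ≠ c → d ≠ a → False := by
  constructor
  · rintro ⟨h1, h2, h3⟩ a b c d hab hbc hcd hda nbc nda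
    have nac : a ≠ c := by rintro rfl; exact hbc hab.symm
    have nbd : b ≠ d := by rintro rfl; exact hda hab.symm
    by_cases hac : G.Adj a c <;> by_cases hbd : G.Adj b d
    · exact h2 (isIndContained_fin_four a b d c hab.ne nda.symm nac nbd nbc hcd.ne.symm
        (by simp [hab, SimpleGraph.cycleGraph_adj])
        (by simp [G.adj_comm a d, hda, SimpleGraph.cycleGraph_adj]; decide)
        (by simp [hac, SimpleGraph.cycleGraph_adj]; decide)
        (by simp [hbd, SimpleGraph.cycleGraph_adj])
        (by simp [hbc, SimpleGraph.cycleGraph_adj])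
        (by simp [hcd.symm, SimpleGraph.cycleGraph_adj]))
    · exact h1 (isIndContained_fin_four b a c d hab.ne.symm nbc nbd nac nda.symm hcd.ne
        (by simp [hab.symm, SimpleGraph.pathGraph_adj])
        (by simp [hbc, SimpleGraph.pathGraph_adj])
        (by simp [hbd, SimpleGraph.pathGraph_adj])
        (by simp [hac, SimpleGraph.pathGraph_adj])
        (by simp [G.adj_comm a d, hda, SimpleGraph.pathGraph_adj])
        (by simp [hcd, SimpleGraph.pathGraph_adj]))
    · exact h1 (isIndContained_fin_four a b d c hab.ne nda.symm nac nbd nbc hcd.ne.symm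
        (by simp [hab, SimpleGraph.pathGraph_adj])
        (by simp [G.adj_comm a d, hda, SimpleGraph.pathGraph_adj])
        (by simp [hac, SimpleGraph.pathGraph_adj])
        (by simp [hbd, SimpleGraph.pathGraph_adj])
        (by simp [hbc, SimpleGraph.pathGraph_adj])
        (by simp [hcd.symm, SimpleGraph.pathGraph_adj]))
    · have hinj : Function.Injective (Sum.elim ![a, b] ![c, d]) := by
        rintro (i | i) (j | j) <;> fin_cases i <;> fin_cases j <;>
          simp [hab.ne, hcd.ne, hab.ne.symm, hcd.ne.symm, nac, nbd, nac.symm, nbd.symm, nbc,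
            nda, nbc.symm, nda.symm]
      refine h3 ⟨⟨⟨Sum.elim ![a, b] ![c, d], hinj⟩, ?_⟩⟩
      intro i j
      change G.Adj (Sum.elim ![a, b] ![c, d] i) (Sum.elim ![a, b] ![c, d] j) ↔ _
      rcases i with i | i <;> rcases j with j | j <;> fin_cases i <;> fin_cases j <;>
        simp [hab, hcd, hac, hbd, hbc, hda, hab.symm, hcd.symm, G.adj_comm a d,
          G.adj_comm c b, G.adj_comm c a, G.adj_comm d b]
  · intro h
    refine ⟨?_, ?_, ?_⟩
    · rintro ⟨f⟩
      refine h (f 0) (f 1) (f 3) (f 2) ?_ ?_ ?_ ?_ ?_ ?_ <;>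
        simp [f.map_adj_iff, SimpleGraph.pathGraph_adj, f.injective.eq_iff]
    · rintro ⟨f⟩
      refine h (f 0) (f 1) (f 3) (f 2) ?_ ?_ ?_ ?_ ?_ ?_ <;>
        simp [f.map_adj_iff, SimpleGraph.cycleGraph_adj, f.injective.eq_iff] <;> decide
    · rintro ⟨f⟩
      refine h (f (.inl 0)) (f (.inl 1)) (f (.inr 0)) (f (.inr 1)) ?_ ?_ ?_ ?_ ?_ ?_ <;>
        simp [f.map_adj_iff, f.injective.eq_iff]

/-- Complementation exchanges the edges and nonedges of an alternating 4-cycle, which becomes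
alternating again after a rotation. -/
theorem IsThreshold.compl {V : Type*} {G : SimpleGraph V} (h : IsThreshold G) :
    IsThreshold Gᶜ := by
  rw [isThreshold_iff] at h ⊢
  intro a b c d hab hbc hcd hda nbc nda
  simp only [SimpleGraph.compl_adj, not_and, not_not] at *
  exact h b c d a (hbc nbc) hcd.2 (hda nda) hab.2 hcd.1 hab.1

theorem isThreshold_compl_iff {V : Type*} {G : SimpleGraph V} :
    IsThreshold Gᶜ ↔ IsThreshold G :=
  ⟨fun h => by simpa using h.compl, IsThreshold.compl⟩

theorem isThreshold_bot {V : Type*} : IsThreshold (⊥ : SimpleGraph V) := by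
  rw [isThreshold_iff]
  intro a b c d hab
  simp at hab

/-- Complementation reverses inclusion and preserves threshold graphs. Because of this, only
deletions need an algorithm. -/
theorem mem_minimalThresholdCompletions_iff {V : Type*} {G H : SimpleGraph V} :
    H ∈ minimalThresholdCompletions G ↔ Hᶜ ∈ minimalThresholdDeletions Gᶜ := by
  simp only [minimalThresholdCompletions, minimalThresholdDeletions, Set.mem_ofPred_eq,
    Minimal, Maximal, isThreshold_compl_iff, compl_le_compl_iff_le]
  refine and_congr_right fun _ => ⟨fun h K hK hle => ?_, fun h K hK hle => ?_⟩
  · have := h (y := Kᶜ) ⟨by simpa using compl_le_compl hK.1, hK.2.compl⟩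
      (by simpa using compl_le_compl hle)
    simpa using compl_le_compl this
  · exact compl_le_compl_iff_le.1
      (h (y := Kᶜ) ⟨compl_le_compl hK.1, hK.2.compl⟩ (compl_le_compl hle))

section Finite

variable {V : Type*} [Finite V]

/-- If `ua` is an edge and `va` is not, every neighbour of `v` other than `u` must be a neighbour of
`u`, or an alternating 4-cycle appears. Then `N(v) \ {u}` is strictly contained in `N(u) \ {v}`, so
`u` has larger degree. -/
theorem IsThreshold.adj_of_ncard_le {G : SimpleGraph V} (hG : IsThreshold G) {u v a : V}
    (hle : (G.neighborSet u).ncard ≤ (G.neighborSet v).ncard) (hua : G.Adj u a) (hav : a ≠ v) :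
    G.Adj v a := by
  rw [isThreshold_iff] at hG
  by_contra hva
  have huv : u ≠ v := by rintro rfl; exact hva hua
  have hsub : ∀ b, G.Adj v b → b ≠ u → G.Adj u b := fun b hb hbu => by
    by_contra hub
    exact hG u a v b hua (fun h => hva h.symm) hb (fun h => hub h.symm) hav hbu
  have hlt : (G.neighborSet v \ {u}).ncard < (G.neighborSet u \ {v}).ncard := by
    apply Set.ncard_lt_ncard _ (Set.toFinite _)
    refine ⟨fun b hb => ⟨hsub b hb.1 hb.2, fun h => ?_⟩, fun h => hva (h ⟨hua, hav⟩).1⟩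
    rw [h] at hb
    exact G.loopless.irrefl _ hb.1
  by_cases h : G.Adj u v
  · have h1 := Set.ncard_sdiff_singleton_add_one (s := G.neighborSet v) (a := u) h.symm
      (Set.toFinite _)
    have h2 := Set.ncard_sdiff_singleton_add_one (s := G.neighborSet u) (a := v) h
      (Set.toFinite _)
    omega
  · rw [Set.sdiff_singleton_eq_self (show v ∉ G.neighborSet u from h),
      Set.sdiff_singleton_eq_self (show u ∉ G.neighborSet v from fun h' => h h'.symm)] at hlt
    omega

/-- Between two threshold graphs one can move by adding a single edge. -/
theorem IsThreshold.exists_sup_edge {H H' : SimpleGraph V} (hH : IsThreshold H)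
    (hH' : IsThreshold H') (hlt : H < H') :
    ∃ u v, H'.Adj u v ∧ ¬ H.Adj u v ∧ IsThreshold (H ⊔ SimpleGraph.edge u v) := by
  classical
  let deg : V → ℕ := fun v => (H.neighborSet v).ncard
  have hne : ∃ p : V × V, H'.Adj p.1 p.2 ∧ ¬ H.Adj p.1 p.2 := by
    by_contra hcon
    push Not at hcon
    exact hlt.not_ge fun u v h => hcon (u, v) h
  obtain ⟨p, hp⟩ := hne
  have : Nonempty {p : V × V // H'.Adj p.1 p.2 ∧ ¬ H.Adj p.1 p.2} := ⟨⟨p, hp⟩⟩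
  -- Among the missing edges, one with the largest degree sum in `H` is added.
  obtain ⟨⟨⟨u, v⟩, huv, hnuv⟩, hmax⟩ := Finite.exists_max
    (fun p : {p : V × V // H'.Adj p.1 p.2 ∧ ¬ H.Adj p.1 p.2} => deg p.1.1 + deg p.1.2)
  replace hmax : ∀ a b, H'.Adj a b → ¬ H.Adj a b → deg a + deg b ≤ deg u + deg v :=
    fun a b h1 h2 => hmax ⟨(a, b), h1, h2⟩
  simp only at huv hnuv
  refine ⟨u, v, huv, hnuv, ?_⟩
  have hnvu : ¬ H.Adj v u := fun h => hnuv h.symm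
  -- An alternating 4-cycle using the new edge `ab` and an old edge `cd` has `deg a < deg c` and
  -- `deg b < deg d`, by nestedness in `H`. If `bc` or `da` were in `H'`, it would be a missing edge
  -- of larger degree sum. So both are nonedges of `H'`, and the 4-cycle is alternating in `H'` too.
  have key : ∀ a b c d, (a = u ∧ b = v ∨ a = v ∧ b = u) → H.Adj c d → ¬ H.Adj b c →
      ¬ H.Adj d a → b ≠ c → d ≠ a → False := by
    intro a b c d hab hcd hbc hda nbc nda
    have hab' : H'.Adj a b := by rcases hab with ⟨rfl, rfl⟩ | ⟨rfl, rfl⟩; exacts [huv, huv.symm]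
    have hnab : ¬ H.Adj a b := by rcases hab with ⟨rfl, rfl⟩ | ⟨rfl, rfl⟩ <;> assumption
    have hsum : deg a + deg b = deg u + deg v := by
      rcases hab with ⟨rfl, rfl⟩ | ⟨rfl, rfl⟩; exacts [rfl, add_comm _ _]
    have h1 : deg a < deg c := by
      by_contra hle
      exact hda (hH.adj_of_ncard_le (not_lt.1 hle) hcd nda).symm
    have h2 : deg b < deg d := by
      by_contra hle
      exact hbc (hH.adj_of_ncard_le (not_lt.1 hle) hcd.symm nbc.symm)
    refine (isThreshold_iff H').1 hH' a b c d hab' (fun h => ?_) (hlt.le hcd) (fun h => ?_) nbc nda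
    · have := hmax b c h hbc; omega
    · have := hmax d a h hda; omega
  rw [isThreshold_iff] at hH ⊢
  intro a b c d hab hbc hcd hda nbc nda
  simp only [SimpleGraph.sup_adj, SimpleGraph.edge_adj, not_or] at hab hbc hcd hda
  rcases hab with hab | hab <;> rcases hcd with hcd | hcd
  · exact hH a b c d hab hbc.1 hcd hda.1 nbc nda
  · exact key c d a b hcd.1 hab hda.1 hbc.1 nda nbc
  · exact key a b c d hab.1 hcd hbc.1 hda.1 nbc nda
  · rcases hab.1 with ⟨rfl, rfl⟩ | ⟨rfl, rfl⟩ <;> rcases hcd.1 with ⟨rfl, rfl⟩ | ⟨rfl, rfl⟩ <;>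
      simp_all

/-- By `IsThreshold.exists_sup_edge`, a threshold subgraph that is not maximal can be enlarged by a
single edge. This makes the greedy extension correct. -/
theorem mem_minimalThresholdDeletions_iff {G H : SimpleGraph V} :
    H ∈ minimalThresholdDeletions G ↔ H ≤ G ∧ IsThreshold H ∧
      ∀ u v, G.Adj u v → ¬ H.Adj u v → ¬ IsThreshold (H ⊔ SimpleGraph.edge u v) := by
  constructor
  · rintro ⟨⟨h1, h2⟩, h3⟩
    refine ⟨h1, h2, fun u v huv hnuv ht => hnuv (h3 ⟨sup_le h1 ?_, ht⟩ le_sup_left ?_)⟩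
    · intro a b hab
      rw [SimpleGraph.edge_adj] at hab
      rcases hab.1 with ⟨rfl, rfl⟩ | ⟨rfl, rfl⟩
      exacts [huv, huv.symm]
    · simp [SimpleGraph.edge_adj, huv.ne]
  · rintro ⟨h1, h2, h3⟩
    refine ⟨⟨h1, h2⟩, fun K hK hle => ?_⟩
    by_contra hcon
    obtain ⟨u, v, huv, hnuv, ht⟩ := h2.exists_sup_edge hK.2 (lt_of_le_not_ge hle hcon)
    exact h3 u v (hK.1 huv) hnuv ht

end Finite

/-! ### Moving between minimal threshold deletions -/

/-- The threshold graph obtained from `S` by keeping the edges at the common neighbours of `c` and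
`x`, and joining `c` to all its neighbours in `G` that are adjacent to these common neighbours. -/
def pivotGraph {V : Type*} (G S : SimpleGraph V) (c x : V) : SimpleGraph V where
  Adj u v := (S.Adj u v ∧ (S.Adj u c ∧ S.Adj u x ∨ S.Adj v c ∧ S.Adj v x)) ∨
    (G.Adj u v ∧ (u = c ∨ v = c) ∧ ∀ w, S.Adj w c ∧ S.Adj w x → S.Adj w u ∧ S.Adj w v)
  symm := ⟨by
    rintro u v (⟨h1, h2⟩ | ⟨h1, h2, h3⟩)
    · exact .inl ⟨h1.symm, h2.symm⟩
    · exact .inr ⟨h1.symm, h2.symm, fun w hw => (h3 w hw).symm⟩⟩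
  loopless := ⟨by
    rintro u (⟨h1, -⟩ | ⟨h1, -⟩)
    exacts [S.loopless.irrefl u h1, G.loopless.irrefl u h1]⟩

theorem pivotGraph_le {V : Type*} {G S : SimpleGraph V} (h : S ≤ G) (c x : V) :
    pivotGraph G S c x ≤ G := by
  rintro u v (h' | h')
  exacts [h h'.1, h'.1]

/-- Let `D` be the set of common neighbours of `c` and `x` in `S`. It is a clique, because `cx` is a
nonedge. No alternating 4-cycle of the pivot graph meets `D`: edges of `S` at `D` are kept, and
endpoints of the edges of the second kind are adjacent to all of `D`. Outside `D` every edge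
contains `c`, but an alternating 4-cycle needs two disjoint edges. -/
theorem isThreshold_pivotGraph {V : Type*} {G S : SimpleGraph V} (hS : IsThreshold S) {c x : V}
    (hcx : ¬ S.Adj c x) (hne : c ≠ x) : IsThreshold (pivotGraph G S c x) := by
  rw [isThreshold_iff] at hS ⊢
  have hclique : ∀ v w, S.Adj v c ∧ S.Adj v x → S.Adj w c ∧ S.Adj w x → v ≠ w → S.Adj v w := by
    intro v w hv hw hvw
    by_contra h
    exact hS c v w x hv.1.symm h hw.2 (fun h => hcx h.symm) hvw hne.symm
  have key : ∀ p q r s, (pivotGraph G S c x).Adj p q → ¬ (pivotGraph G S c x).Adj q r →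
      (pivotGraph G S c x).Adj r s → ¬ (pivotGraph G S c x).Adj s p → q ≠ r → s ≠ p →
      ¬ (S.Adj p c ∧ S.Adj p x) := by
    intro p q r s hpq hqr hrs hsp nqr nsp hp
    have hsp' : ¬ S.Adj s p := fun h => hsp (.inl ⟨h, .inr hp⟩)
    rcases hrs with ⟨hrs, hD⟩ | ⟨-, -, h⟩
    · rcases hD with hr | hs
      · have hqr' : ¬ S.Adj q r := fun h => hqr (.inl ⟨h, .inr hr⟩)
        rcases hpq with ⟨hpq, -⟩ | ⟨-, -, h⟩
        · exact hS p q r s hpq hqr' hrs hsp' nqr nsp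
        · exact hqr' (h r hr).2.symm
      · exact hsp' (hclique s p hs hp nsp)
    · exact hsp' (h p hp).2.symm
  intro p q r s hpq hqr hrs hsp nqr nsp
  have hp := key p q r s hpq hqr hrs hsp nqr nsp
  have hq := key q p s r hpq.symm (fun h => hsp h.symm) hrs.symm (fun h => hqr h.symm)
    nsp.symm nqr.symm
  have hr := key r s p q hrs hsp hpq hqr nsp nqr
  have hs := key s r q p hrs.symm (fun h => hqr h.symm) hpq.symm (fun h => hsp h.symm)
    nqr.symm nsp.symm
  have h1 : p = c ∨ q = c := by
    rcases hpq with ⟨-, h | h⟩ | h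
    exacts [absurd h hp, absurd h hq, h.2.1]
  have h2 : r = c ∨ s = c := by
    rcases hrs with ⟨-, h | h⟩ | h
    exacts [absurd h hr, absurd h hs, h.2.1]
  rcases h1 with rfl | rfl <;> rcases h2 with rfl | rfl
  · exact hqr hpq.symm
  · exact nsp rfl
  · exact nqr rfl
  · exact hsp hpq.symm

section Finite

variable {V : Type*} [Finite V]

/-- A measure of how much of `T` is contained in `S`. -/
def commonPart (T S : SimpleGraph V) : Set V :=
  {v | (∀ a, T.Adj v a → S.Adj v a) ∧ ∀ w, (∃ a, T.Adj w a ∧ ¬ S.Adj w a) →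
    (T.neighborSet w).ncard ≤ (T.neighborSet v).ncard}

/-- Call a vertex bad if some `T`-edge at it is missing from `S`. With `c` bad of maximal `T`-degree
and `x` chosen as below, `c` joins the common part and nothing leaves it. The claim covers all `S'`
above the pivot graph because the greedy extension is not controlled further. -/
theorem exists_pivotGraph_closer {G S T : SimpleGraph V}
    (hS : S ∈ minimalThresholdDeletions G) (hT : T ∈ minimalThresholdDeletions G) (hne : S ≠ T) :
    ∃ c x, IsThreshold (pivotGraph G S c x) ∧
      ∀ S', pivotGraph G S c x ≤ S' → (commonPart T S).ncard < (commonPart T S').ncard := by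
  have hSt := hS.1.2
  have hTt := hT.1.2
  have hbad : ∃ c, ∃ a, T.Adj c a ∧ ¬ S.Adj c a := by
    by_contra hcon
    push Not at hcon
    -- Without bad vertices `T ≤ S`, and the maximality of `T` forces equality.
    have hTS : T ≤ S := fun u v h => hcon u v h
    exact hne (le_antisymm (hT.2 hS.1 hTS) hTS)
  obtain ⟨c0, hc0⟩ := hbad
  have : Nonempty {c // ∃ a, T.Adj c a ∧ ¬ S.Adj c a} := ⟨⟨c0, hc0⟩⟩
  obtain ⟨⟨c, x0, hx0⟩, hmax⟩ := Finite.exists_max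
    (fun p : {c // ∃ a, T.Adj c a ∧ ¬ S.Adj c a} => (T.neighborSet p.1).ncard)
  replace hmax : ∀ w, (∃ a, T.Adj w a ∧ ¬ S.Adj w a) →
      (T.neighborSet w).ncard ≤ (T.neighborSet c).ncard := fun w hw => hmax ⟨w, hw⟩
  have : Nonempty {a // T.Adj c a ∧ ¬ S.Adj c a} := ⟨⟨x0, hx0⟩⟩
  obtain ⟨⟨x, hcx, hncx⟩, hmin⟩ := Finite.exists_min
    (fun p : {a // T.Adj c a ∧ ¬ S.Adj c a} => (S.neighborSet p.1).ncard)
  replace hmin : ∀ a, T.Adj c a → ¬ S.Adj c a →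
      (S.neighborSet x).ncard ≤ (S.neighborSet a).ncard := fun a h1 h2 => hmin ⟨a, h1, h2⟩
  have hnxc : ¬ S.Adj x c := fun h => hncx h.symm
  have hxbad : ∃ a, T.Adj x a ∧ ¬ S.Adj x a := ⟨c, hcx.symm, hnxc⟩
  have hcU : c ∉ commonPart T S := fun h => hncx (h.1 x hcx)
  have hxU : x ∉ commonPart T S := fun h => hnxc (h.1 c hcx.symm)
  -- A vertex `u` of the common part has `T`-degree at least that of `c`, hence is `T`-adjacent to
  -- `x`. As `x` is bad too, its `T`-degree is at most that of `c`, so `u` is also `T`-adjacent to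
  -- `c`. Both edges lie in `S`, which makes `u` a common neighbour of `c` and `x`, and its edges
  -- survive the pivoting.
  have hUx : ∀ u ∈ commonPart T S, T.Adj u x := fun u hu =>
    hTt.adj_of_ncard_le (hu.2 c ⟨x, hcx, hncx⟩) hcx (by rintro rfl; exact hxU hu)
  have hUc : ∀ u ∈ commonPart T S, T.Adj u c := fun u hu =>
    (hTt.adj_of_ncard_le (hmax x hxbad) (hUx u hu).symm (by rintro rfl; exact hcU hu)).symm
  refine ⟨c, x, isThreshold_pivotGraph hSt hncx hcx.ne, fun S' hS' => ?_⟩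
  have hD : ∀ u ∈ commonPart T S, S.Adj u c ∧ S.Adj u x := fun u hu =>
    ⟨hu.1 c (hUc u hu), hu.1 x (hUx u hu)⟩
  have hgood : ∀ u ∈ commonPart T S, ∀ a, T.Adj u a → S'.Adj u a := fun u hu a ha =>
    hS' (.inl ⟨hu.1 a ha, .inl (hD u hu)⟩)
  have hc : ∀ a, T.Adj c a → S'.Adj c a := by
    intro a ha
    apply hS'
    by_cases haD : S.Adj a c ∧ S.Adj a x
    · exact .inl ⟨haD.1.symm, .inr haD⟩
    -- It remains that each common neighbour `w` is `S`-adjacent to `a`. If `ca` is in `S`, the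
    -- contrary gives the alternating 4-cycle `a c x w`. Otherwise `a` has at least the `S`-degree
    -- of `x`, by the choice of `x`, and inherits its neighbour `w`.
    refine .inr ⟨hT.1.1 ha, .inl rfl, fun w hw => ⟨hw.1, ?_⟩⟩
    by_cases hca : S.Adj c a
    · by_contra hwa
      have hax : ¬ S.Adj a x := fun h => haD ⟨hca.symm, h⟩
      exact (isThreshold_iff S).1 hSt a c x w hca.symm hncx hw.2.symm hwa hcx.ne
        (by rintro rfl; exact hax hw.2)
    · exact (hSt.adj_of_ncard_le (hmin a ha hca) hw.2.symm
        (by rintro rfl; exact hca hw.1.symm)).symm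
  -- A vertex of larger `T`-degree than `c` is not bad for `S`, so it lies in the common part and
  -- loses nothing.
  have hmax' : ∀ w, (∃ a, T.Adj w a ∧ ¬ S'.Adj w a) →
      (T.neighborSet w).ncard ≤ (T.neighborSet c).ncard := by
    rintro w ⟨a, h1, h2⟩
    by_contra hlt
    push Not at hlt
    refine h2 (hgood w ⟨?_, fun v hv => (hmax v hv).trans hlt.le⟩ a h1)
    intro b hb
    by_contra hb'
    exact hlt.not_ge (hmax w ⟨b, hb, hb'⟩)
  apply Set.ncard_lt_ncard _ (Set.toFinite _)
  refine ⟨fun u hu => ⟨hgood u hu, fun w hw => (hmax' w hw).trans (hu.2 c ⟨x, hcx, hncx⟩)⟩,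
    fun h => hcU (h ⟨hc, hmax'⟩)⟩

/-- A set of minimal threshold deletions that contains one and is closed under pivoting contains
all of them. -/
theorem mem_of_pivotGraph_closed {G : SimpleGraph V} {C : Set (SimpleGraph V)}
    (hC : C ⊆ minimalThresholdDeletions G) (hne : C.Nonempty)
    (hclosed : ∀ S ∈ C, ∀ c x, IsThreshold (pivotGraph G S c x) →
      ∃ S' ∈ C, pivotGraph G S c x ≤ S') {T : SimpleGraph V}
    (hT : T ∈ minimalThresholdDeletions G) : T ∈ C := by
  obtain ⟨S0, hS0⟩ := hne
  have : Nonempty C := ⟨⟨S0, hS0⟩⟩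
  obtain ⟨⟨S, hS⟩, hmax⟩ := Finite.exists_max (fun S : C => (commonPart T S.1).ncard)
  by_contra hTC
  obtain ⟨c, x, h1, h2⟩ := exists_pivotGraph_closer (hC hS) hT (by rintro rfl; exact hTC hS)
  obtain ⟨S', hS', hle⟩ := hclosed S hS c x h1
  exact (h2 S' hle).not_ge (hmax ⟨S', hS'⟩)

end Finite

/-! ### Executions of the machine -/

namespace RAM

/-- The machine gets from `c` to `c'` with trace `l`. -/
def Runs (c : Config) (l : List (ℕ × Option ℕ)) (c' : Config) : Prop :=
  step^[l.length] c = c' ∧ trace l.length c = l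

theorem Runs.single (c : Config) : Runs c [(stepCost c, stepOutput c)] (step c) := ⟨rfl, rfl⟩

theorem trace_add (M N : ℕ) (c : Config) : trace (M + N) c = trace M c ++ trace N (step^[M] c) := by
  induction M generalizing c with
  | zero => simp [trace]
  | succ M ih => rw [Nat.succ_add, trace, ih, trace]; rfl

theorem Runs.trans {c₁ c₂ c₃ : Config} {l₁ l₂ : List (ℕ × Option ℕ)} (h₁ : Runs c₁ l₁ c₂)
    (h₂ : Runs c₂ l₂ c₃) : Runs c₁ (l₁ ++ l₂) c₃ := by
  obtain ⟨h₁, h₁'⟩ := h₁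
  obtain ⟨h₂, h₂'⟩ := h₂
  refine ⟨?_, ?_⟩
  · rw [List.length_append, add_comm, Function.iterate_add_apply, h₁, h₂]
  · rw [List.length_append, trace_add, h₁, h₁', h₂']

theorem Runs.cons {c c' : Config} {l : List (ℕ × Option ℕ)} (h : Runs (step c) l c') :
    Runs c ((stepCost c, stepOutput c) :: l) c' :=
  (Runs.single c).trans h

/-- The total cost of a trace. -/
def totalCost (l : List (ℕ × Option ℕ)) : ℕ := (l.map Prod.fst).sum

@[simp] theorem totalCost_nil : totalCost [] = 0 := rfl

@[simp] theorem totalCost_cons (x : ℕ × Option ℕ) (l : List (ℕ × Option ℕ)) :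
    totalCost (x :: l) = x.1 + totalCost l := by simp [totalCost]

@[simp] theorem totalCost_append (l₁ l₂ : List (ℕ × Option ℕ)) :
    totalCost (l₁ ++ l₂) = totalCost l₁ + totalCost l₂ := by simp [totalCost]

theorem delays_append_of_silent (l₁ l₂ : List (ℕ × Option ℕ)) (h : ∀ x ∈ l₁, x.2 = none) (acc : ℕ) :
    delays acc (l₁ ++ l₂) = delays (acc + totalCost l₁) l₂ := by
  induction l₁ generalizing acc with
  | nil => simp
  | cons x l₁ ih =>
    obtain ⟨c, o⟩ := x
    obtain rfl : o = none := h (c, o) (by simp)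
    simp only [List.cons_append, delays, totalCost_cons]
    rw [ih (fun y hy => h y (by simp [hy])), add_assoc]

theorem outputs_of_silent {l : List (ℕ × Option ℕ)} (h : ∀ x ∈ l, x.2 = none) :
    outputs l = [] := by
  simpa [outputs, List.filterMap_eq_nil_iff] using h

/-- Started with memory `m`, the program `P` terminates in time `t`, without any output, with a
memory that satisfies `Q`. -/
def Does (P : Prog) (m : Memory) (t : ℕ) (Q : Memory → Prop) : Prop :=
  ∃ m', Q m' ∧ ∀ K, ∃ l, Runs ⟨P :: K, m⟩ l ⟨K, m'⟩ ∧ (∀ x ∈ l, x.2 = none) ∧ totalCost l ≤ t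

theorem Does.mono {P : Prog} {m : Memory} {t t' : ℕ} {Q Q' : Memory → Prop} (h : Does P m t Q)
    (ht : t ≤ t') (hQ : ∀ m', Q m' → Q' m') : Does P m t' Q' := by
  obtain ⟨m', h1, h2⟩ := h
  refine ⟨m', hQ m' h1, fun K => ?_⟩
  obtain ⟨l, h3, h4, h5⟩ := h2 K
  exact ⟨l, h3, h4, h5.trans ht⟩

theorem Does.skip {m : Memory} {t : ℕ} {Q : Memory → Prop} (hQ : Q m) (ht : 1 ≤ t) :
    Does .skip m t Q :=
  ⟨m, hQ, fun K => ⟨_, Runs.single _, by simp [stepOutput], by simpa [stepCost] using ht⟩⟩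

theorem Does.write {a : ℕ} {e₁ e₂ : Expr} {m : Memory} {t : ℕ} {Q : Memory → Prop}
    (ht : e₁.cost m + e₂.cost m + (e₁.eval m).size + (e₂.eval m).size + 1 ≤ t)
    (hQ : Q (Function.update m a (Function.update (m a) (e₁.eval m) (e₂.eval m)))) :
    Does (.write a e₁ e₂) m t Q :=
  ⟨_, hQ, fun K => ⟨_, Runs.single _, by simp [stepOutput], by simpa [stepCost] using ht⟩⟩

theorem Does.seq {P P' : Prog} {m : Memory} {t₁ t₂ t : ℕ} {Q Q' : Memory → Prop}
    (h₁ : Does P m t₁ Q) (h₂ : ∀ m', Q m' → Does P' m' t₂ Q') (ht : t₁ + t₂ + 1 ≤ t) :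
    Does (.seq P P') m t Q' := by
  obtain ⟨m₁, hm₁, h₁⟩ := h₁
  obtain ⟨m₂, hm₂, h₂⟩ := h₂ m₁ hm₁
  refine ⟨m₂, hm₂, fun K => ?_⟩
  obtain ⟨l₁, a₁, b₁, c₁⟩ := h₁ (P' :: K)
  obtain ⟨l₂, a₂, b₂, c₂⟩ := h₂ K
  refine ⟨_, Runs.cons (c := ⟨.seq P P' :: K, m⟩) (a₁.trans a₂), ?_, ?_⟩
  · simp only [stepOutput, List.mem_cons, List.mem_append]
    rintro x (rfl | h | h)
    exacts [rfl, b₁ x h, b₂ x h]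
  · simp only [stepCost, totalCost_cons, totalCost_append]
    omega

theorem Does.ite {e : Expr} {P P' : Prog} {m : Memory} {t t' : ℕ} {Q : Memory → Prop}
    (h₁ : e.eval m ≠ 0 → Does P m t' Q) (h₂ : e.eval m = 0 → Does P' m t' Q)
    (ht : e.cost m + 1 + t' ≤ t) : Does (.ite e P P') m t Q := by
  have h : Does (if e.eval m ≠ 0 then P else P') m t' Q := by
    split_ifs with h
    exacts [h₁ h, h₂ (not_not.1 h)]
  obtain ⟨m₁, hm₁, h⟩ := h
  refine ⟨m₁, hm₁, fun K => ?_⟩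
  obtain ⟨l₁, a₁, b₁, c₁⟩ := h K
  refine ⟨_, Runs.cons (c := ⟨.ite e P P' :: K, m⟩) a₁, ?_, ?_⟩
  · simp only [stepOutput, List.mem_cons]
    rintro x (rfl | h)
    exacts [rfl, b₁ x h]
  · simp only [stepCost, totalCost_cons]
    omega

/-- Induction on the number of remaining passes. Each pass pays for a test and the body; the summand
`c + 1` outside the product pays for the final failing test. -/
theorem Does.loop {e : Expr} {P : Prog} {c t k : ℕ} (I : ℕ → Memory → Prop)
    (hbody : ∀ i < k, ∀ m, I i m → e.eval m ≠ 0 ∧ e.cost m ≤ c ∧ Does P m t (I (i + 1)))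
    (hend : ∀ m, I k m → e.eval m = 0 ∧ e.cost m ≤ c) {m : Memory} (hm : I 0 m) :
    Does (.loop e P) m (k * (c + 1 + t) + c + 1) (I k) := by
  have key : ∀ j ≤ k, ∀ m, I (k - j) m → Does (.loop e P) m (j * (c + 1 + t) + c + 1) (I k) := by
    intro j
    induction j with
    | zero =>
      intro _ m hm
      obtain ⟨h1, h2⟩ := hend m hm
      refine ⟨m, hm, fun K => ⟨[(e.cost m + 1, none)], ⟨?_, rfl⟩, by simp, ?_⟩⟩
      · simp [step, h1]
      · simp only [totalCost_cons, totalCost_nil]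
        omega
    | succ j ih =>
      intro hj m hm
      obtain ⟨h1, h2, m₁, hm₁, h3⟩ := hbody (k - (j + 1)) (by omega) m hm
      rw [show k - (j + 1) + 1 = k - j by omega] at hm₁
      obtain ⟨m₂, hm₂, h4⟩ := ih (by omega) m₁ hm₁
      refine ⟨m₂, hm₂, fun K => ?_⟩
      obtain ⟨l₁, a₁, b₁, c₁⟩ := h3 (.loop e P :: K)
      obtain ⟨l₂, a₂, b₂, c₂⟩ := h4 K
      refine ⟨_, Runs.cons (c := ⟨.loop e P :: K, m⟩) (l := l₁ ++ l₂) ?_, ?_, ?_⟩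
      · simp only [step, if_pos h1]
        exact a₁.trans a₂
      · simp only [stepOutput, List.mem_cons, List.mem_append]
        rintro x (rfl | h | h)
        exacts [rfl, b₁ x h, b₂ x h]
      · simp only [stepCost, totalCost_cons, totalCost_append]
        rw [add_mul]
        omega
  exact key k le_rfl m (by simpa using hm)

theorem BinOp.size_apply_le (o : BinOp) (x y : ℕ) :
    (o.apply x y).size ≤ x.size + y.size + 1 := by
  have hx := Nat.lt_size_self x
  have hy := Nat.lt_size_self y
  have h1 : (2 : ℕ) ^ x.size ≤ 2 ^ (x.size + y.size) := Nat.pow_le_pow_right (by simp) (by omega)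
  have h2 : (2 : ℕ) ^ y.size ≤ 2 ^ (x.size + y.size) := Nat.pow_le_pow_right (by simp) (by omega)
  have h3 : 1 ≤ (2 : ℕ) ^ (x.size + y.size) := Nat.one_le_two_pow
  rw [Nat.size_le, pow_succ]
  cases o <;> simp only [BinOp.apply]
  · omega
  · omega
  · have : x * y < 2 ^ x.size * 2 ^ y.size := Nat.mul_lt_mul'' hx hy
    rw [← pow_add] at this
    omega
  · have := Nat.div_le_self x y
    omega
  · have := Nat.mod_le x y
    omega
  · split_ifs <;> omega
  · split_ifs <;> omega

/-! ### Expressions with bounded recursion -/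

/-- Scalar register number `j` used for the evaluation of expressions. -/
def reg (j : ℕ) : Expr := .read (11 + j) (.const 0)

/-- Assignment to the register number `j`. -/
def setReg (j : ℕ) (e : Expr) : Prog := .write (11 + j) (.const 0) e

/-- The cell `0` of array `a`. -/
def cell (a : ℕ) : Expr := .read a (.const 0)

theorem Does.setReg {j : ℕ} {e : Expr} {m : Memory} {t : ℕ} {Q : Memory → Prop}
    (ht : e.cost m + (e.eval m).size + 2 ≤ t)
    (hQ : ∀ m' : Memory, m' (11 + j) 0 = e.eval m → (∀ a, a ≠ 11 + j → m' a = m a) → Q m') :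
    Does (setReg j e) m t Q := by
  refine Does.write ?_ (hQ _ ?_ ?_)
  · simp only [Expr.cost, Expr.eval, Nat.size_zero]
    omega
  · simp [Expr.eval]
  · intro a ha
    simp [Function.update_of_ne ha]

/-- Expressions with variables, access to the arrays below `11`, and recursion: `fold ℓ init body`
iterates `body` as many times as the content of cell `0` of array `0` says, with the variables `ℓ`
and `ℓ + 1` being the counter and the current value; `bind ℓ e body` evaluates `body` with the
value of `e` for the variable `ℓ`. The values of variables are reduced modulo the content of
cell `0` of array `4`. -/
inductive LoopExpr
  | const (k : ℕ)
  | var (j : ℕ)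
  | tab (a : ℕ) (e : LoopExpr)
  | op (o : BinOp) (e₁ e₂ : LoopExpr)
  | fold (l : ℕ) (init body : LoopExpr)
  | bind (l : ℕ) (e body : LoopExpr)

/-- `f (i - 1) (… (f 1 (f 0 x)))`. -/
def iter {α : Type*} (f : ℕ → α → α) (x : α) : ℕ → α
  | 0 => x
  | i + 1 => f i (iter f x i)

namespace LoopExpr

/-- Reducing bound values modulo the content of array `4` bounds their bit length unconditionally,
so running times follow from the syntax alone. Codes of graphs and indicators lie below the modulus
and are not affected. -/
def eval (tbl : Memory) : (ℕ → ℕ) → LoopExpr → ℕ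
  | _, const k => k
  | env, var j => env j
  | env, tab a e => tbl a (e.eval tbl env)
  | env, op o e₁ e₂ => o.apply (e₁.eval tbl env) (e₂.eval tbl env)
  | env, fold l init body =>
      iter (fun i x => body.eval tbl (Function.update (Function.update env l i) (l + 1) x) %
        tbl 4 0) (init.eval tbl env % tbl 4 0) (tbl 0 0)
  | env, bind l e body => body.eval tbl (Function.update env l (e.eval tbl env % tbl 4 0))

/-- A program that computes the value into register `d`, leaving the registers below `d` alone. -/
def compile : ℕ → LoopExpr → Prog
  | d, const k => setReg d (.const k)
  | d, var j => setReg d (reg j)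
  | d, tab a e => .seq (e.compile d) (setReg d (.read a (reg d)))
  | d, op o e₁ e₂ => .seq (e₁.compile d) (.seq (e₂.compile (d + 1))
      (setReg d (.op o (reg d) (reg (d + 1)))))
  | d, fold l init body => .seq (init.compile d) (.seq (setReg (l + 1) (.op .mod (reg d) (cell 4)))
      (.seq (setReg l (.const 0)) (.seq (.loop (.op .lt (reg l) (cell 0))
        (.seq (body.compile (l + 2)) (.seq (setReg (l + 1) (.op .mod (reg (l + 2)) (cell 4)))
          (setReg l (.op .add (reg l) (.const 1)))))) (setReg d (reg (l + 1))))))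
  | d, bind l e body => .seq (e.compile d) (.seq (setReg l (.op .mod (reg d) (cell 4)))
      (.seq (body.compile (l + 1)) (setReg d (reg (l + 1)))))

/-- All variables are bound, and levels increase. -/
def wf : List ℕ → ℕ → LoopExpr → Bool
  | _, _, const _ => true
  | vs, _, var j => decide (j ∈ vs)
  | vs, d, tab a e => decide (a < 11) && e.wf vs d
  | vs, d, op _ e₁ e₂ => e₁.wf vs d && e₂.wf vs (d + 1)
  | vs, d, fold l init body =>
      decide (d ≤ l) && init.wf vs d && body.wf (l :: (l + 1) :: vs) (l + 2)
  | vs, d, bind l e body => decide (d ≤ l) && e.wf vs d && body.wf (l :: vs) (l + 1)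

/-- The size of the value is at most this number times the size of the variables. -/
def weight : LoopExpr → ℕ
  | const k => k.size
  | var _ => 1
  | tab _ _ => 1
  | op _ e₁ e₂ => e₁.weight + e₂.weight + 1
  | fold _ _ _ => 1
  | bind _ _ body => body.weight

/-- A bound for the time of `compile`. -/
def time (n B : ℕ) : LoopExpr → ℕ
  | const k => 2 * k.size + 3
  | var _ => 2 * B + 4
  | tab _ e => e.time n B + 2 * (e.weight * B) + 2 * B + 6
  | op _ e₁ e₂ => e₁.time n B + e₂.time n B + 4 * (e₁.weight * B) + 4 * (e₂.weight * B) + 11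
  | fold _ init body => init.time n B + 2 * (init.weight * B) +
      n * (body.time n B + 2 * (body.weight * B) + 12 * B + 29) + 13 * B + 29
  | bind _ e body => e.time n B + 2 * (e.weight * B) + body.time n B + 2 * (body.weight * B)
      + 5 * B + 20

/-- The assumptions on the arrays under which expressions are evaluated. -/
structure Bounded (tbl : Memory) (B : ℕ) : Prop where
  cap_pos : 0 < tbl 4 0
  one_le : 1 ≤ B
  size_le : ∀ a < 11, ∀ k, (tbl a k).size ≤ B

theorem Bounded.size_le_of_lt {tbl : Memory} {B x : ℕ} (h : Bounded tbl B) (hx : x < tbl 4 0) :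
    x.size ≤ B :=
  (Nat.size_le_size hx.le).trans (h.size_le 4 (by norm_num) 0)

/-- Only arithmetic accumulates size. Look-ups and folds have weight `1` whatever they contain,
since table entries are bounded by assumption and the result of a fold is reduced below the cap. -/
theorem size_eval_le {tbl : Memory} {B : ℕ} (hb : Bounded tbl B) (e : LoopExpr) :
    ∀ (vs : List ℕ) (d : ℕ) (env : ℕ → ℕ), e.wf vs d = true →
      (∀ j ∈ vs, (env j).size ≤ B) → (e.eval tbl env).size ≤ e.weight * B := by
  have hB := hb.one_le
  induction e with
  | const k =>
    intro vs d env _ _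
    simp only [eval, weight]
    exact Nat.le_mul_of_pos_right _ hB
  | var j =>
    intro vs d env hwf henv
    simp only [wf, decide_eq_true_eq] at hwf
    simpa [eval, weight] using henv j hwf
  | tab a e ih =>
    intro vs d env hwf henv
    simp only [wf, Bool.and_eq_true, decide_eq_true_eq] at hwf
    simpa [eval, weight] using hb.size_le a hwf.1 _
  | op o e₁ e₂ ih₁ ih₂ =>
    intro vs d env hwf henv
    simp only [wf, Bool.and_eq_true] at hwf
    have h1 := ih₁ vs d env hwf.1 henv
    have h2 := ih₂ vs (d + 1) env hwf.2 henv
    have h3 := o.size_apply_le (e₁.eval tbl env) (e₂.eval tbl env)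
    simp only [eval, weight, add_mul, one_mul]
    omega
  | fold l init body _ _ =>
    intro vs d env hwf henv
    simp only [eval, weight, one_mul]
    apply hb.size_le_of_lt
    cases tbl 0 0 with
    | zero => exact Nat.mod_lt _ hb.cap_pos
    | succ n => exact Nat.mod_lt _ hb.cap_pos
  | bind l e body _ ih =>
    intro vs d env hwf henv
    simp only [wf, Bool.and_eq_true, decide_eq_true_eq] at hwf
    simp only [eval, weight]
    refine ih _ _ _ hwf.2 fun j hj => ?_
    by_cases hjl : j = l
    · subst hjl
      simpa using hb.size_le_of_lt (Nat.mod_lt _ hb.cap_pos)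
    · rw [Function.update_of_ne hjl]
      exact henv j (by simpa [hjl] using hj)

/-- Correctness and running time of `compile`. -/
theorem does_compile {tbl : Memory} {B : ℕ} (hb : Bounded tbl B) (e : LoopExpr) :
    ∀ (vs : List ℕ) (d : ℕ) (env : ℕ → ℕ) (m : Memory), e.wf vs d = true →
      (∀ j ∈ vs, j < d ∧ m (11 + j) 0 = env j ∧ (env j).size ≤ B) → (∀ a < 11, m a = tbl a) →
      Does (e.compile d) m (e.time (tbl 0 0) B)
        (fun m' => (∀ a < 11 + d, m' a = m a) ∧ m' (11 + d) 0 = e.eval tbl env) := by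
  have hB := hb.one_le
  have hcap : (tbl 4 0).size ≤ B := hb.size_le 4 (by norm_num) 0
  induction e with
  | const k =>
    intro vs d env m _ _ _
    refine Does.setReg ?_ fun m' h1 h2 => ⟨fun a ha => h2 a (by omega), h1⟩
    simp only [Expr.cost, Expr.eval, time]
    omega
  | var j =>
    intro vs d env m hwf henv _
    simp only [wf, decide_eq_true_eq] at hwf
    obtain ⟨h3, h4, h5⟩ := henv j hwf
    refine Does.setReg ?_ fun m' h1 h2 => ⟨fun a ha => h2 a (by omega), ?_⟩
    · simp only [reg, Expr.cost, Expr.eval, time, h4, Nat.size_zero]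
      omega
    · simpa [eval, reg, Expr.eval, h4] using h1
  | tab a e ih =>
    intro vs d env m hwf henv htbl
    simp only [wf, Bool.and_eq_true, decide_eq_true_eq] at hwf
    have hs := size_eval_le hb e vs d env hwf.2 (fun j hj => (henv j hj).2.2)
    have hs' := hb.size_le a hwf.1 (e.eval tbl env)
    refine Does.seq (t₂ := 2 * (e.weight * B) + 2 * B + 5)
      (ih vs d env m hwf.2 henv htbl) ?_ (by simp only [time]; omega)
    rintro m₁ ⟨h1, h2⟩
    have ha : m₁ a = tbl a := by rw [h1 a (by omega), htbl a hwf.1]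
    refine Does.setReg ?_ fun m' h3 h4 =>
      ⟨fun a ha => by rw [h4 a (by omega), h1 a ha], ?_⟩
    · simp only [reg, Expr.cost, Expr.eval, h2, ha, Nat.size_zero]
      omega
    · simpa [eval, reg, Expr.eval, h2, ha] using h3
  | op o e₁ e₂ ih₁ ih₂ =>
    intro vs d env m hwf henv htbl
    simp only [wf, Bool.and_eq_true] at hwf
    have hs₁ := size_eval_le hb e₁ vs d env hwf.1 (fun j hj => (henv j hj).2.2)
    have hs₂ := size_eval_le hb e₂ vs (d + 1) env hwf.2 (fun j hj => (henv j hj).2.2)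
    have hs₃ := o.size_apply_le (e₁.eval tbl env) (e₂.eval tbl env)
    refine Does.seq (t₂ := e₂.time (tbl 0 0) B + 4 * (e₁.weight * B) + 4 * (e₂.weight * B) + 10)
      (ih₁ vs d env m hwf.1 henv htbl) ?_ (by simp only [time]; omega)
    rintro m₁ ⟨h1, h2⟩
    refine Does.seq (t₂ := 4 * (e₁.weight * B) + 4 * (e₂.weight * B) + 9)
      (ih₂ vs (d + 1) env m₁ hwf.2 (fun j hj => ?_) (fun a ha => ?_)) ?_ (by omega)
    · obtain ⟨h3, h4, h5⟩ := henv j hj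
      exact ⟨by omega, by rw [h1 _ (by omega), h4], h5⟩
    · rw [h1 a (by omega), htbl a ha]
    rintro m₂ ⟨h3, h4⟩
    have h5 : m₂ (11 + d) 0 = e₁.eval tbl env := by rw [h3 _ (by omega), h2]
    refine Does.setReg ?_ fun m' h6 h7 =>
      ⟨fun a ha => by rw [h7 a (by omega), h3 a (by omega), h1 a ha], ?_⟩
    · simp only [reg, Expr.cost, Expr.eval, h4, h5, Nat.size_zero]
      omega
    · simpa [eval, reg, Expr.eval, h4, h5] using h6
  | fold l init body ih₁ ih₂ =>
    intro vs d env m hwf henv htbl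
    simp only [wf, Bool.and_eq_true, decide_eq_true_eq] at hwf
    obtain ⟨⟨hdl, hwf₁⟩, hwf₂⟩ := hwf
    have hs₁ := size_eval_le hb init vs d env hwf₁ (fun j hj => (henv j hj).2.2)
    have hn : (tbl 0 0).size ≤ B := hb.size_le 0 (by norm_num) 0
    set n := tbl 0 0 with hn_def
    set f : ℕ → ℕ → ℕ := fun i x =>
      body.eval tbl (Function.update (Function.update env l i) (l + 1) x) % tbl 4 0 with hf
    set x₀ := init.eval tbl env % tbl 4 0 with hx₀
    have hlt : ∀ i, iter f x₀ i < tbl 4 0 := by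
      intro i
      cases i with
      | zero => exact Nat.mod_lt _ hb.cap_pos
      | succ n => exact Nat.mod_lt _ hb.cap_pos
    have hsz : ∀ i, (iter f x₀ i).size ≤ B := fun i => hb.size_le_of_lt (hlt i)
    let t₃ := n * (4 * B + 6 + 1 + (body.time n B + 2 * (body.weight * B) + 8 * B + 20)) +
      (4 * B + 6) + 1
    have ht₃ : t₃ ≤ n * (body.time n B + 2 * (body.weight * B) + 12 * B + 29) + 4 * B + 7 := by
      have : n * (4 * B + 6 + 1 + (body.time n B + 2 * (body.weight * B) + 8 * B + 20)) ≤
          n * (body.time n B + 2 * (body.weight * B) + 12 * B + 29) :=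
        Nat.mul_le_mul_left _ (by omega)
      simp only [t₃]
      omega
    refine Does.seq (t₂ := t₃ + 2 * (init.weight * B) + 9 * B + 20)
      (ih₁ vs d env m hwf₁ henv htbl) ?_ (by simp only [time]; omega)
    rintro m₁ ⟨h1, h2⟩
    have hm₁cap : m₁ 4 0 = tbl 4 0 := by rw [h1 4 (by omega), htbl 4 (by norm_num)]
    refine Does.seq (t₁ := 2 * (init.weight * B) + 4 * B + 7) (t₂ := t₃ + 2 * B + 12)
      (Q := fun m₂ => (∀ a < 11 + d, m₂ a = m a) ∧ m₂ (11 + (l + 1)) 0 = x₀)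
      (Does.setReg ?_ fun m₂ h3 h4 => ⟨fun a ha => ?_, ?_⟩) ?_ (by omega)
    · have h5 := hb.size_le_of_lt (Nat.mod_lt (init.eval tbl env) hb.cap_pos)
      simp only [reg, cell, Expr.cost, Expr.eval, h2, hm₁cap, BinOp.apply, Nat.size_zero]
      omega
    · rw [h4 a (by omega), h1 a (by omega)]
    · simpa [reg, cell, Expr.eval, h2, hm₁cap, BinOp.apply] using h3
    rintro m₂ ⟨h3, h4⟩
    refine Does.seq (t₁ := 3) (t₂ := t₃ + 2 * B + 5)
      (Q := fun m₃ => (∀ a < 11 + d, m₃ a = m a) ∧ m₃ (11 + (l + 1)) 0 = iter f x₀ 0 ∧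
        m₃ (11 + l) 0 = 0)
      (Does.setReg ?_ fun m₃ h5 h6 => ⟨fun a ha => ?_, ?_, ?_⟩) ?_ (by omega)
    · simp [Expr.cost, Expr.eval]
    · rw [h6 a (by omega), h3 a ha]
    · rw [h6 _ (by omega), h4]; rfl
    · simpa [Expr.eval] using h5
    intro m₃ hm₃
    -- Register `l` holds the counter and `l + 1` the current value. The body is compiled at level
    -- `l + 2`, so it disturbs neither these nor any variable bound outside.
    refine Does.seq (t₂ := 2 * B + 4) (Does.loop
      (I := fun i m₃ => (∀ a < 11 + d, m₃ a = m a) ∧ m₃ (11 + (l + 1)) 0 = iter f x₀ i ∧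
        m₃ (11 + l) 0 = i) (k := n) (c := 4 * B + 6)
        (t := body.time n B + 2 * (body.weight * B) + 8 * B + 20) ?_ ?_ hm₃) ?_ (by omega)
    · rintro i hi m₄ ⟨h5, h6, h7⟩
      have hm₄n : m₄ 0 0 = n := by rw [h5 0 (by omega), htbl 0 (by norm_num)]
      have his : i.size ≤ B := (Nat.size_le_size hi.le).trans hn
      refine ⟨by simp [reg, cell, Expr.eval, h7, hm₄n, BinOp.apply, hi], ?_, ?_⟩
      · simp only [reg, cell, Expr.cost, Expr.eval, h7, hm₄n, BinOp.apply, if_pos hi, Nat.size_zero,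
          Nat.size_one]
        omega
      have henv' : ∀ j ∈ l :: (l + 1) :: vs, j < l + 2 ∧ m₄ (11 + j) 0 =
          Function.update (Function.update env l i) (l + 1) (iter f x₀ i) j ∧
          (Function.update (Function.update env l i) (l + 1) (iter f x₀ i) j).size ≤ B := by
        intro j hj
        by_cases hj1 : j = l + 1
        · subst hj1
          simp [h6, hsz i]
        by_cases hj2 : j = l
        · subst hj2
          simp [h7, his]
        simp only [List.mem_cons, hj1, hj2, false_or] at hj
        obtain ⟨h8, h9, h10⟩ := henv j hj
        rw [Function.update_of_ne hj1, Function.update_of_ne hj2, h5 _ (by omega)]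
        exact ⟨by omega, h9, h10⟩
      have hs₂ := size_eval_le hb body _ _ _ hwf₂ (fun j hj => (henv' j hj).2.2)
      refine Does.seq (t₂ := 2 * (body.weight * B) + 8 * B + 19)
        (ih₂ _ (l + 2) _ m₄ hwf₂ henv' (fun a ha => by rw [h5 a (by omega), htbl a ha])) ?_
        (by omega)
      rintro m₅ ⟨h8, h9⟩
      have hm₅cap : m₅ 4 0 = tbl 4 0 := by
        rw [h8 4 (by omega), h5 4 (by omega), htbl 4 (by norm_num)]
      refine Does.seq (t₁ := 2 * (body.weight * B) + 4 * B + 7) (t₂ := 4 * B + 11)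
        (Q := fun m₆ => (∀ a < 11 + d, m₆ a = m a) ∧ m₆ (11 + (l + 1)) 0 = iter f x₀ (i + 1) ∧
          m₆ (11 + l) 0 = i)
        (Does.setReg ?_ fun m₆ h10 h11 => ⟨fun a ha => ?_, ?_, ?_⟩) ?_ (by omega)
      · have h12 := hb.size_le_of_lt (Nat.mod_lt (body.eval tbl (Function.update
          (Function.update env l i) (l + 1) (iter f x₀ i))) hb.cap_pos)
        simp only [reg, cell, Expr.cost, Expr.eval, h9, hm₅cap, BinOp.apply, Nat.size_zero]
        omega
      · rw [h11 a (by omega), h8 a (by omega), h5 a ha]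
      · rw [h10]
        simp only [reg, cell, Expr.eval, h9, hm₅cap, BinOp.apply]
        rfl
      · rw [h11 _ (by omega), h8 _ (by omega), h7]
      rintro m₆ ⟨h10, h11, h12⟩
      refine Does.setReg ?_ fun m₇ h13 h14 => ⟨fun a ha => ?_, ?_, ?_⟩
      · have : (i + 1).size ≤ B := (Nat.size_le_size hi).trans hn
        simp only [reg, Expr.cost, Expr.eval, h12, BinOp.apply, Nat.size_zero, Nat.size_one]
        omega
      · rw [h14 a (by omega), h10 a ha]
      · rw [h14 _ (by omega), h11]
      · simpa [reg, Expr.eval, h12, BinOp.apply] using h13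
    · rintro m₄ ⟨h5, h6, h7⟩
      have hm₄n : m₄ 0 0 = n := by rw [h5 0 (by omega), htbl 0 (by norm_num)]
      refine ⟨by simp [reg, cell, Expr.eval, h7, hm₄n, BinOp.apply], ?_⟩
      simp only [reg, cell, Expr.cost, Expr.eval, h7, hm₄n, BinOp.apply, lt_irrefl, if_false,
        Nat.size_zero]
      omega
    rintro m₄ ⟨h5, h6, h7⟩
    have := hsz n
    refine Does.setReg ?_ fun m₅ h8 h9 => ⟨fun a ha => ?_, ?_⟩
    · simp only [reg, Expr.cost, Expr.eval, h6, Nat.size_zero]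
      omega
    · rw [h9 a (by omega), h5 a ha]
    · rw [h8]
      simp only [reg, Expr.eval, h6]
      rfl
  | bind l e body ih₁ ih₂ =>
    intro vs d env m hwf henv htbl
    simp only [wf, Bool.and_eq_true, decide_eq_true_eq] at hwf
    obtain ⟨⟨hdl, hwf₁⟩, hwf₂⟩ := hwf
    have hs₁ := size_eval_le hb e vs d env hwf₁ (fun j hj => (henv j hj).2.2)
    set x := e.eval tbl env % tbl 4 0 with hx
    have hxs : x.size ≤ B := hb.size_le_of_lt (Nat.mod_lt _ hb.cap_pos)
    refine Does.seq (t₂ := 2 * (e.weight * B) + body.time (tbl 0 0) B + 2 * (body.weight * B)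
      + 5 * B + 19) (ih₁ vs d env m hwf₁ henv htbl) ?_ (by simp only [time]; omega)
    rintro m₁ ⟨h1, h2⟩
    have hm₁cap : m₁ 4 0 = tbl 4 0 := by rw [h1 4 (by omega), htbl 4 (by norm_num)]
    refine Does.seq (t₁ := 2 * (e.weight * B) + 4 * B + 7)
      (t₂ := body.time (tbl 0 0) B + 2 * (body.weight * B) + B + 11)
      (Q := fun m₂ => (∀ a < 11 + d, m₂ a = m a) ∧ m₂ (11 + l) 0 = x)
      (Does.setReg ?_ fun m₂ h3 h4 => ⟨fun a ha => ?_, ?_⟩) ?_ (by omega)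
    · rw [hx] at hxs
      simp only [reg, cell, Expr.cost, Expr.eval, h2, hm₁cap, BinOp.apply, Nat.size_zero]
      omega
    · rw [h4 a (by omega), h1 a (by omega)]
    · simpa [reg, cell, Expr.eval, h2, hm₁cap, BinOp.apply] using h3
    rintro m₂ ⟨h3, h4⟩
    have henv' : ∀ j ∈ l :: vs, j < l + 1 ∧ m₂ (11 + j) 0 = Function.update env l x j ∧
        (Function.update env l x j).size ≤ B := by
      intro j hj
      by_cases hj2 : j = l
      · subst hj2
        simp [h4, hxs]
      simp only [List.mem_cons, hj2, false_or] at hj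
      obtain ⟨h8, h9, h10⟩ := henv j hj
      rw [Function.update_of_ne hj2, h3 _ (by omega)]
      exact ⟨by omega, h9, h10⟩
    have hs₂ := size_eval_le hb body _ _ _ hwf₂ (fun j hj => (henv' j hj).2.2)
    refine Does.seq (t₂ := 2 * (body.weight * B) + 4)
      (ih₂ _ (l + 1) _ m₂ hwf₂ henv' (fun a ha => by rw [h3 a (by omega), htbl a ha])) ?_
      (by omega)
    rintro m₃ ⟨h5, h6⟩
    refine Does.setReg ?_ fun m₄ h8 h9 => ⟨fun a ha => ?_, ?_⟩
    · simp only [reg, Expr.cost, Expr.eval, h6, Nat.size_zero]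
      omega
    · rw [h9 a (by omega), h5 a (by omega), h3 a ha]
    · rw [h8]
      simp only [reg, Expr.eval, h6]
      rfl

end LoopExpr

end RAM

namespace RAM

/-! ### Space is bounded by time -/

/-- All arrays that the program writes have numbers below this one. -/
def Prog.arrayBound : Prog → ℕ
  | .skip => 0
  | .write a _ _ => a + 1
  | .emit _ => 0
  | .seq P Q => max P.arrayBound Q.arrayBound
  | .ite _ P Q => max P.arrayBound Q.arrayBound
  | .loop _ P => P.arrayBound

/-- The nonzero cells lie in the arrays below `A`, and their addresses and contents have at most
`D` bits. -/
def SmallMemory (A D : ℕ) (m : Memory) : Prop :=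
  ∀ a k, m a k ≠ 0 → a < A ∧ k.size ≤ D ∧ (m a k).size ≤ D

/-- At most `A * 2 ^ D` cells are relevant, each taking at most `D + 1` bits. -/
theorem SmallMemory.fitsIn {A D : ℕ} {m : Memory} (h : SmallMemory A D m) :
    FitsIn m (2 ^ (A + (D + (D + 1)))) := by
  refine ⟨A, fun _ => 2 ^ D, ?_, ?_⟩
  · intro a k hak
    by_contra hne
    obtain ⟨h1, h2, -⟩ := h a k hne
    rw [Nat.size_le] at h2
    rcases hak with h | h
    · omega
    · exact absurd h2 (not_lt.2 h)
  · have hle : ∀ a k, (m a k).size + 1 ≤ D + 1 := by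
      intro a k
      by_cases h0 : m a k = 0
      · simp [h0]
      · have := (h a k h0).2.2
        omega
    calc ∑ a ∈ Finset.range A, ∑ k ∈ Finset.range (2 ^ D), ((m a k).size + 1)
        ≤ ∑ a ∈ Finset.range A, ∑ k ∈ Finset.range (2 ^ D), (D + 1) :=
          Finset.sum_le_sum fun a _ => Finset.sum_le_sum fun k _ => hle a k
      _ = A * (2 ^ D * (D + 1)) := by simp
      _ ≤ 2 ^ A * (2 ^ D * 2 ^ (D + 1)) :=
          Nat.mul_le_mul Nat.lt_two_pow_self.le (Nat.mul_le_mul_left _ Nat.lt_two_pow_self.le)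
      _ = 2 ^ (A + (D + (D + 1))) := by ring

theorem smallMemory_update {A D a k v : ℕ} {m : Memory} (h : SmallMemory A D m) (ha : a < A)
    (hk : k.size ≤ D) (hv : v.size ≤ D) :
    SmallMemory A D (Function.update m a (Function.update (m a) k v)) := by
  intro b j hb
  by_cases hba : b = a
  · subst hba
    by_cases hjk : j = k
    · subst hjk
      simpa using ⟨ha, hk, hv⟩
    · simp only [Function.update_self, Function.update_of_ne hjk] at hb ⊢
      exact h b j hb
  · simp only [Function.update_of_ne hba] at hb ⊢
    exact h b j hb

/-- Under logarithmic cost, a write costs at least the bit lengths of the address and of the value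
written, so the bound `D` on the cost bounds both. -/
theorem smallMemory_step {A D : ℕ} {c : Config} (h : SmallMemory A D c.mem)
    (hA : ∀ P ∈ c.todo, P.arrayBound ≤ A) (hD : stepCost c ≤ D) :
    SmallMemory A D (step c).mem ∧ ∀ P ∈ (step c).todo, P.arrayBound ≤ A := by
  obtain ⟨todo, m⟩ := c
  rcases todo with _ | ⟨P, K⟩
  · exact ⟨h, hA⟩
  have hP := hA P (by simp)
  have hK : ∀ P ∈ K, P.arrayBound ≤ A := fun P hP => hA P (by simp [hP])
  cases P with
  | skip => exact ⟨h, hK⟩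
  | write a e₁ e₂ =>
    simp only [stepCost] at hD
    exact ⟨smallMemory_update h hP (by omega) (by omega), hK⟩
  | emit e => exact ⟨h, hK⟩
  | seq P Q =>
    simp only [Prog.arrayBound, max_le_iff] at hP
    refine ⟨h, ?_⟩
    simp only [step, List.mem_cons]
    rintro R (rfl | rfl | hR)
    exacts [hP.1, hP.2, hK R hR]
  | ite e P Q =>
    simp only [Prog.arrayBound, max_le_iff] at hP
    refine ⟨h, ?_⟩
    simp only [step, List.mem_cons]
    rintro R (rfl | hR)
    · split_ifs
      exacts [hP.1, hP.2]
    · exact hK R hR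
  | loop e P =>
    refine ⟨h, ?_⟩
    simp only [step]
    split_ifs
    · simp only [List.mem_cons]
      rintro R (rfl | rfl | hR)
      exacts [hP, hP, hK R hR]
    · exact hK

/-- Every step is part of some delay, so delay bounds are bounds for single steps. Together with
`smallMemory_step` this turns polynomial delay into exponential space. -/
theorem cost_le_of_delays_le {D : ℕ} (l : List (ℕ × Option ℕ)) (acc : ℕ)
    (h : ∀ d ∈ delays acc l, d ≤ D) : acc ≤ D ∧ ∀ x ∈ l, x.1 ≤ D := by
  induction l generalizing acc with
  | nil => simpa [delays] using h
  | cons x l ih =>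
    obtain ⟨c, o⟩ := x
    have key : acc + c ≤ D ∧ ∀ x ∈ l, x.1 ≤ D := by
      cases o with
      | none => exact ih (acc + c) h
      | some o =>
        exact ⟨h _ (by simp [delays]), (ih 0 fun d hd => h d (by simp [delays, hd])).2⟩
    refine ⟨by omega, ?_⟩
    simp only [List.mem_cons]
    rintro y (rfl | hy)
    · simp only
      omega
    · exact key.2 y hy

theorem smallMemory_iterate {A D : ℕ} (N : ℕ) (c : Config) (h : SmallMemory A D c.mem)
    (hA : ∀ P ∈ c.todo, P.arrayBound ≤ A) (hD : ∀ x ∈ trace N c, x.1 ≤ D) :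
    ∀ k ≤ N, SmallMemory A D (step^[k] c).mem := by
  induction N generalizing c with
  | zero =>
    intro k hk
    obtain rfl : k = 0 := by omega
    exact h
  | succ N ih =>
    intro k hk
    obtain ⟨h1, h2⟩ := smallMemory_step h hA (hD (stepCost c, stepOutput c) (by simp [trace]))
    cases k with
    | zero => exact h
    | succ k =>
      exact ih (step c) h1 h2 (fun x hx => hD x (by simp [trace, hx])) k (by omega)

/-! ### Polynomially bounded functions -/

/-- The function is bounded by a polynomial. -/
def PolyBounded (f : ℕ → ℕ) : Prop := ∃ p : Polynomial ℕ, ∀ n, f n ≤ p.eval n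

theorem PolyBounded.const (c : ℕ) : PolyBounded fun _ => c := ⟨.C c, by simp⟩

theorem PolyBounded.id : PolyBounded fun n => n := ⟨.X, by simp⟩

theorem PolyBounded.add {f g : ℕ → ℕ} (hf : PolyBounded f) (hg : PolyBounded g) :
    PolyBounded fun n => f n + g n := by
  obtain ⟨p, hp⟩ := hf
  obtain ⟨q, hq⟩ := hg
  exact ⟨p + q, fun n => by simpa using add_le_add (hp n) (hq n)⟩

theorem PolyBounded.mul {f g : ℕ → ℕ} (hf : PolyBounded f) (hg : PolyBounded g) :
    PolyBounded fun n => f n * g n := by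
  obtain ⟨p, hp⟩ := hf
  obtain ⟨q, hq⟩ := hg
  exact ⟨p * q, fun n => by simpa using Nat.mul_le_mul (hp n) (hq n)⟩

theorem LoopExpr.polyBounded_time {B : ℕ → ℕ} (hB : PolyBounded B) (e : LoopExpr) :
    PolyBounded fun n => e.time n (B n) := by
  have hc := PolyBounded.const
  induction e with
  | const k => exact hc _
  | var j => exact ((hc 2).mul hB).add (hc 4)
  | tab a e ih =>
    exact ((ih.add ((hc 2).mul ((hc _).mul hB))).add ((hc 2).mul hB)).add (hc 6)
  | op o e₁ e₂ ih₁ ih₂ =>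
    exact (((ih₁.add ih₂).add ((hc 4).mul ((hc _).mul hB))).add
      ((hc 4).mul ((hc _).mul hB))).add (hc 11)
  | fold l init body ih₁ ih₂ =>
    exact (((ih₁.add ((hc 2).mul ((hc _).mul hB))).add (PolyBounded.id.mul
      (((ih₂.add ((hc 2).mul ((hc _).mul hB))).add ((hc 12).mul hB)).add (hc 29)))).add
      ((hc 13).mul hB)).add (hc 29)
  | bind l e body ih₁ ih₂ =>
    exact ((((ih₁.add ((hc 2).mul ((hc _).mul hB))).add ih₂).add
      ((hc 2).mul ((hc _).mul hB))).add ((hc 5).mul hB)).add (hc 20)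

/-! ### Traversal of an implicitly given graph -/

section Traversal

variable (start next out : LoopExpr)

/-- Puts the powers of two into array `2` and the modulus into array `4`. -/
def initTables : Prog :=
  .seq (.write 2 (.const 0) (.const 1)) (.seq
    (.loop (.op .lt (cell 3) (.op .mul (.op .add (cell 0) (.const 1)) (.op .add (cell 0) (.const 1))))
      (.seq (.write 2 (.op .add (cell 3) (.const 1)) (.op .mul (.read 2 (cell 3)) (.const 2)))
        (.write 3 (.const 0) (.op .add (cell 3) (.const 1)))))
    (.write 4 (.const 0) (.read 2 (cell 3))))

/-- Puts the first node into the queue (array `9`, between the positions in arrays `7` and `8`)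
and marks it in array `10`. -/
def initQueue : Prog :=
  .seq (start.compile 0) (.seq (.write 9 (.const 0) (reg 0)) (.seq (.write 10 (reg 0) (.const 1))
    (.write 8 (.const 0) (.const 1))))

/-- Takes a node from the queue and prepares its output. -/
def popNode : Prog :=
  .seq (.write 5 (.const 0) (.read 9 (cell 7))) (.seq (.write 7 (.const 0) (.op .add (cell 7) (.const 1)))
    (.seq (.write 6 (.const 0) (.const 0)) (out.compile 0)))

/-- Appends one neighbour of the current node to the queue unless it is marked. -/
def pushNode : Prog :=
  .seq (next.compile 0) (.seq (.ite (.read 10 (reg 0)) .skip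
    (.seq (.write 10 (reg 0) (.const 1)) (.seq (.write 9 (cell 8) (reg 0))
      (.write 8 (.const 0) (.op .add (cell 8) (.const 1))))))
    (.write 6 (.const 0) (.op .add (cell 6) (.const 1))))

def pushNodes : Prog := .loop (.op .lt (cell 6) (.op .mul (cell 0) (cell 0))) (pushNode next)

def mainLoop : Prog :=
  .loop (.op .lt (cell 7) (cell 8)) (.seq (popNode out) (.seq (.emit (reg 0)) (pushNodes next)))

/-- The traversal of a graph, whose nodes are numbers, from the node `start`: the neighbours of the
node in array `5` are the values of `next`, as the number in array `6` varies; the output for a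
node is the value of `out`. -/
def traversal : Prog :=
  .seq initTables (.seq (initQueue start) (mainLoop next out))

end Traversal

/-- The tables on which the expressions rely. -/
structure Tables (n : ℕ) (A : ℕ → ℕ) (m : Memory) : Prop where
  size_eq : m 0 0 = n
  input_eq : m 1 = A
  pow_eq : ∀ k < (n + 1) * (n + 1), m 2 k = 2 ^ k
  cap_eq : m 4 0 = 2 ^ ((n + 1) * (n + 1))

/-- A bound for the sizes of all numbers in the arrays below `11`. -/
def wordSize (n : ℕ) : ℕ := (n + 1) * (n + 1) + 1

theorem polyBounded_wordSize : PolyBounded wordSize :=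
  ((PolyBounded.id.add (.const 1)).mul (PolyBounded.id.add (.const 1))).add (.const 1)

/-- What the expressions compute; the nodes form the set `C`. -/
structure TraversalSpec (start next out : LoopExpr) (n : ℕ) (A : ℕ → ℕ) (C : Set ℕ) (s : ℕ)
    (nb : ℕ → ℕ → ℕ) (o : ℕ → ℕ) : Prop where
  start_eq : ∀ m env, Tables n A m → start.eval m env = s
  next_eq : ∀ m env, Tables n A m → m 5 0 ∈ C → m 6 0 < n * n →
    next.eval m env = nb (m 5 0) (m 6 0)
  out_eq : ∀ m env, Tables n A m → m 5 0 ∈ C → out.eval m env = o (m 5 0)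
  start_mem : s ∈ C
  next_mem : ∀ x ∈ C, ∀ k < n * n, nb x k ∈ C
  lt : ∀ x ∈ C, x < 2 ^ (n * n)
  out_lt : ∀ x ∈ C, o x < 2 ^ (n * n)

/-- The invariant of the traversal: `Q` is the list of all nodes found so far, and the first `h` of
them have been taken from the queue. -/
structure TraversalInv (n : ℕ) (A : ℕ → ℕ) (C : Set ℕ) (Q : List ℕ) (h : ℕ) (m : Memory) :
    Prop where
  tables : Tables n A m
  size_le : ∀ a < 11, ∀ k, (m a k).size ≤ wordSize n
  nodup : Q.Nodup
  mem : ∀ x ∈ Q, x ∈ C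
  head_eq : m 7 0 = h
  tail_eq : m 8 0 = Q.length
  queue_eq : ∀ i < Q.length, Q[i]? = some (m 9 i)
  mark_eq : ∀ x, m 10 x = if x ∈ Q then 1 else 0

end RAM

/-! ### Correctness and cost of the phases of the traversal -/

namespace RAM

/-- The memory `m` with cell `k` of array `a` changed to `v`. -/
def setAt (m : Memory) (a k v : ℕ) : Memory := fun b j => if b = a ∧ j = k then v else m b j

theorem setAt_of_ne {m : Memory} {a k v b : ℕ} (h : b ≠ a) : setAt m a k v b = m b := by
  funext j
  simp [setAt, h]

theorem update_eq_setAt (m : Memory) (a k v : ℕ) :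
    Function.update m a (Function.update (m a) k v) = setAt m a k v := by
  funext b j
  by_cases hb : b = a
  · subst hb
    by_cases hj : j = k
    · subst hj; simp [setAt]
    · simp [setAt, hj]
  · simp [setAt, hb]

theorem size_setAt_le {m : Memory} {S a k v : ℕ} (h : ∀ a < 11, ∀ k, (m a k).size ≤ S)
    (hv : v.size ≤ S) : ∀ b < 11, ∀ j, (setAt m a k v b j).size ≤ S := by
  intro b hb j
  unfold setAt
  split_ifs
  exacts [hv, h b hb j]

theorem Does.writeAt {a k v : ℕ} {e₁ e₂ : Expr} {m : Memory} {t : ℕ} {Q : Memory → Prop}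
    (hk : e₁.eval m = k) (hv : e₂.eval m = v)
    (ht : e₁.cost m + e₂.cost m + k.size + v.size + 1 ≤ t) (hQ : Q (setAt m a k v)) :
    Does (.write a e₁ e₂) m t Q := by
  subst hk hv
  exact Does.write ht (by rwa [update_eq_setAt])

theorem BinOp.apply_add (x y : ℕ) : BinOp.add.apply x y = x + y := rfl
theorem BinOp.apply_sub (x y : ℕ) : BinOp.sub.apply x y = x - y := rfl
theorem BinOp.apply_mul (x y : ℕ) : BinOp.mul.apply x y = x * y := rfl
theorem BinOp.apply_div (x y : ℕ) : BinOp.div.apply x y = x / y := rfl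
theorem BinOp.apply_mod (x y : ℕ) : BinOp.mod.apply x y = x % y := rfl
theorem BinOp.apply_lt (x y : ℕ) : BinOp.lt.apply x y = if x < y then 1 else 0 := rfl
theorem BinOp.apply_eq (x y : ℕ) : BinOp.eq.apply x y = if x = y then 1 else 0 := rfl

theorem size_ite_le (p : Prop) [Decidable p] : (if p then 1 else 0 : ℕ).size ≤ 1 := by
  split_ifs <;> simp

theorem size_le_of_le_two_pow {x b : ℕ} (h : x ≤ 2 ^ b) : x.size ≤ b + 1 := by
  rw [← Nat.size_pow]
  exact Nat.size_le_size h

theorem size_le_of_le {x S : ℕ} (h : x ≤ S) : x.size ≤ S :=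
  (Nat.size_le.2 Nat.lt_two_pow_self).trans h

theorem Tables.bounded {n : ℕ} {A : ℕ → ℕ} {m : Memory} (h : Tables n A m)
    (hs : ∀ a < 11, ∀ k, (m a k).size ≤ wordSize n) : LoopExpr.Bounded m (wordSize n) :=
  ⟨by rw [h.cap_eq]; positivity, by simp [wordSize], hs⟩

theorem Tables.congr {n : ℕ} {A : ℕ → ℕ} {m m' : Memory} (h : Tables n A m)
    (h0 : m' 0 = m 0) (h1 : m' 1 = m 1) (h2 : m' 2 = m 2) (h4 : m' 4 = m 4) :
    Tables n A m' :=
  ⟨by rw [h0, h.size_eq], by rw [h1, h.input_eq], by rw [h2]; exact h.pow_eq,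
    by rw [h4, h.cap_eq]⟩

theorem TraversalInv.congr {n : ℕ} {A : ℕ → ℕ} {C : Set ℕ} {Q : List ℕ} {h : ℕ} {m m' : Memory}
    (hi : TraversalInv n A C Q h m) (ha : ∀ a < 11, a ≠ 5 → a ≠ 6 → m' a = m a)
    (hs : ∀ a < 11, ∀ k, (m' a k).size ≤ wordSize n) : TraversalInv n A C Q h m' where
  tables := hi.tables.congr (ha 0 (by simp) (by simp) (by simp)) (ha 1 (by simp) (by simp) (by simp))
    (ha 2 (by simp) (by simp) (by simp)) (ha 4 (by simp) (by simp) (by simp))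
  size_le := hs
  nodup := hi.nodup
  mem := hi.mem
  head_eq := by rw [ha 7 (by simp) (by simp) (by simp), hi.head_eq]
  tail_eq := by rw [ha 8 (by simp) (by simp) (by simp), hi.tail_eq]
  queue_eq := by rw [ha 9 (by simp) (by simp) (by simp)]; exact hi.queue_eq
  mark_eq := by rw [ha 10 (by simp) (by simp) (by simp)]; exact hi.mark_eq

/-- Bounds the queue positions, so that they have at most `b + 1` bits. -/
theorem length_le_two_pow {b : ℕ} {Q : List ℕ} (hQ : Q.Nodup) (h : ∀ x ∈ Q, x < 2 ^ b) :
    Q.length ≤ 2 ^ b := by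
  rw [← List.toFinset_card_of_nodup hQ, ← Finset.card_range (2 ^ b)]
  exact Finset.card_le_card fun x hx => Finset.mem_range.2 (h x (List.mem_toFinset.1 hx))

theorem does_initTables {n : ℕ} {A : ℕ → ℕ} {m : Memory} (h0 : m 0 0 = n) (h0' : ∀ k, k ≠ 0 → m 0 k = 0)
    (h1 : m 1 = A) (hA : ∀ k, A k ≤ 1) (hz : ∀ a, 2 ≤ a → ∀ k, m a k = 0) :
    Does initTables m (((n + 1) * (n + 1)) * (70 * wordSize n + 120) + 60 * wordSize n + 100)
      (fun m' => Tables n A m' ∧ (∀ a < 11, ∀ k, (m' a k).size ≤ wordSize n) ∧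
        ∀ a, 5 ≤ a → ∀ k, m' a k = 0) := by
  set T := (n + 1) * (n + 1) with hT
  set S := wordSize n with hS
  have hST : S = T + 1 := rfl
  have hn1 : (n + 1).size ≤ S := size_le_of_le (by rw [hST, hT]; nlinarith)
  have hn : n.size ≤ S := size_le_of_le (by rw [hST, hT]; nlinarith)
  have hTS : T.size ≤ S := size_le_of_le (by omega)
  have hpow : ∀ i ≤ T, (2 ^ i).size ≤ S := fun i hi => by rw [Nat.size_pow]; omega
  unfold initTables
  refine Does.seq (t₁ := 8) (t₂ := T * (70 * S + 120) + 60 * S + 90)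
    (Q := fun m' => m' 3 0 = 0 ∧ (∀ a, a ≠ 2 → a ≠ 3 → m' a = m a) ∧ (∀ k, k ≠ 0 → m' 3 k = 0) ∧
      ∀ k, m' 2 k = if k ≤ 0 then 2 ^ k else 0)
    (Does.writeAt rfl rfl (by simp [Expr.cost, Expr.eval]) ⟨?_, ?_, ?_, ?_⟩) ?_ (by omega)
  · simp [setAt, hz]
  · intro a ha _
    rw [setAt_of_ne ha]
  · intro k _
    simp [setAt, hz]
  · intro k
    by_cases hk : k = 0 <;> simp [setAt, hz, Expr.eval, hk]
  intro m₁ hm₁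
  -- After `i` passes, array `2` holds the powers up to `2 ^ i` and cell `0` of array `3` holds `i`.
  -- Hence `2 ^ T` is available at the end, to be copied as the modulus. The constants in all these
  -- time bounds are generous; only polynomial growth matters.
  refine Does.seq (t₁ := T * ((20 * S + 30) + 1 + (50 * S + 80)) + (20 * S + 30) + 1)
    (t₂ := 10 * S + 20)
    (Does.loop (I := fun i m' => m' 3 0 = i ∧ (∀ a, a ≠ 2 → a ≠ 3 → m' a = m a) ∧
      (∀ k, k ≠ 0 → m' 3 k = 0) ∧ ∀ k, m' 2 k = if k ≤ i then 2 ^ k else 0) ?_ ?_ hm₁) ?_ ?_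
  · rintro i hi m₂ ⟨h3, hne, h3', h2⟩
    have hm0 : m₂ 0 0 = n := by rw [hne 0 (by simp) (by simp), h0]
    have his : i.size ≤ S := size_le_of_le (by omega)
    have his1 : (i + 1).size ≤ S := size_le_of_le (by omega)
    refine ⟨?_, ?_, ?_⟩
    · simp [cell, Expr.eval, h3, hm0, BinOp.apply_lt, BinOp.apply_add, BinOp.apply_mul, ← hT, hi]
    · simp only [cell, Expr.eval, Expr.cost, h3, hm0, BinOp.apply_lt, BinOp.apply_add,
        BinOp.apply_mul, ← hT, if_pos hi, Nat.size_zero, Nat.size_one]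
      omega
    have h2i : m₂ 2 i = 2 ^ i := by simp [h2]
    have hp1 := hpow i hi.le
    have hp2 := hpow (i + 1) hi
    rw [pow_succ] at hp2
    have hsz2 : Nat.size 2 = 2 := rfl
    refine Does.seq (t₁ := 30 * S + 40) (t₂ := 20 * S + 39)
      (Q := fun m' => m' 3 0 = i ∧ (∀ a, a ≠ 2 → a ≠ 3 → m' a = m a) ∧
      (∀ k, k ≠ 0 → m' 3 k = 0) ∧ ∀ k, m' 2 k = if k ≤ i + 1 then 2 ^ k else 0)
      (Does.writeAt (k := i + 1) (v := 2 ^ i * 2) ?_ ?_ ?_ ⟨?_, ?_, ?_, ?_⟩) ?_ (by omega)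
    · simp [cell, Expr.eval, h3, BinOp.apply_add]
    · simp [cell, Expr.eval, h3, h2i, BinOp.apply_mul]
    · simp only [cell, Expr.eval, Expr.cost, h3, h2i, BinOp.apply_add,
        BinOp.apply_mul, Nat.size_zero, Nat.size_one, hsz2]
      omega
    · simp [setAt, h3]
    · intro a ha ha'
      rw [setAt_of_ne ha, hne a ha ha']
    · intro k hk
      simp [setAt, h3' k hk]
    · intro k
      by_cases hk : k = i + 1
      · simp [setAt, hk, pow_succ]
      · simp only [setAt, hk, and_false, if_false, h2]
        congr 1
        apply propext
        omega
    rintro m₃ ⟨g3, gne, g3', g2⟩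
    refine Does.writeAt (k := 0) (v := i + 1) rfl ?_ ?_ ⟨?_, ?_, ?_, ?_⟩
    · simp [cell, Expr.eval, g3, BinOp.apply_add]
    · simp only [cell, Expr.eval, Expr.cost, g3, BinOp.apply_add, Nat.size_zero, Nat.size_one]
      omega
    · simp [setAt]
    · intro a ha ha'
      rw [setAt_of_ne ha', gne a ha ha']
    · intro k hk
      simp [setAt, g3' k hk, hk]
    · intro k
      rw [setAt_of_ne (by simp), g2]
  · rintro m₂ ⟨h3, hne, h3', h2⟩
    have hm0 : m₂ 0 0 = n := by rw [hne 0 (by simp) (by simp), h0]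
    refine ⟨?_, ?_⟩
    · simp [cell, Expr.eval, h3, hm0, BinOp.apply_lt, BinOp.apply_add, BinOp.apply_mul, ← hT]
    · simp only [cell, Expr.eval, Expr.cost, h3, hm0, BinOp.apply_lt, BinOp.apply_add,
        BinOp.apply_mul, ← hT, lt_irrefl, if_false, Nat.size_zero, Nat.size_one]
      omega
  · rintro m₂ ⟨h3, hne, h3', h2⟩
    have h2T : m₂ 2 T = 2 ^ T := by simp [h2]
    have hp := hpow T le_rfl
    refine Does.writeAt (k := 0) (v := 2 ^ T) rfl ?_ ?_ ⟨⟨?_, ?_, ?_, ?_⟩, ?_, ?_⟩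
    · simp [cell, Expr.eval, h3, h2T]
    · simp only [cell, Expr.eval, Expr.cost, h3, h2T, Nat.size_zero]
      omega
    · rw [setAt_of_ne (by simp), hne 0 (by simp) (by simp), h0]
    · rw [setAt_of_ne (by simp), hne 1 (by simp) (by simp), h1]
    · intro k hk
      rw [setAt_of_ne (by simp), h2, if_pos hk.le]
    · simp [setAt, hT]
    · refine size_setAt_le (fun a _ k => ?_) hp
      by_cases ha2 : a = 2
      · subst ha2
        rw [h2]
        split_ifs with hk
        exacts [hpow k hk, by simp]
      by_cases ha3 : a = 3
      · subst ha3
        by_cases hk : k = 0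
        · rwa [hk, h3]
        · simp [h3' k hk]
      rw [hne a ha2 ha3]
      by_cases ha0 : a = 0
      · subst ha0
        by_cases hk : k = 0
        · rwa [hk, h0]
        · simp [h0' k hk]
      by_cases ha1 : a = 1
      · subst ha1
        rw [h1]
        exact size_le_of_le ((hA k).trans (by omega))
      · simp [hz a (by omega) k]
    · intro a ha k
      rw [setAt_of_ne (by omega), hne a (by omega) (by omega), hz a (by omega)]
  · have : T * (20 * S + 30 + 1 + (50 * S + 80)) ≤ T * (70 * S + 120) :=
      Nat.mul_le_mul_left _ (by omega)
    omega

section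

variable {start next out : LoopExpr} {n : ℕ} {A : ℕ → ℕ} {C : Set ℕ} {s : ℕ} {nb : ℕ → ℕ → ℕ}
  {o : ℕ → ℕ}

theorem sq_lt_wordSize (n : ℕ) : n * n + 1 ≤ wordSize n := by
  unfold wordSize
  nlinarith

theorem TraversalSpec.size_le (h : TraversalSpec start next out n A C s nb o) {x : ℕ}
    (hx : x ∈ C) : x.size ≤ wordSize n :=
  (size_le_of_le_two_pow (h.lt x hx).le).trans (sq_lt_wordSize n)

theorem does_initQueue (hsp : TraversalSpec start next out n A C s nb o)
    (hwf : start.wf [] 0 = true) {m : Memory} (ht : Tables n A m)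
    (hsz : ∀ a < 11, ∀ k, (m a k).size ≤ wordSize n) (hz : ∀ a, 5 ≤ a → ∀ k, m a k = 0) :
    Does (initQueue start) m (start.time n (wordSize n) + 20 * wordSize n + 50)
      (TraversalInv n A C [s] 0) := by
  have hss := hsp.size_le hsp.start_mem
  have h1S : 1 ≤ wordSize n := by simp [wordSize]
  have hn := ht.size_eq
  have hc := LoopExpr.does_compile (ht.bounded hsz) start [] 0 (fun _ => 0) m hwf (by simp)
    (fun _ _ => rfl)
  rw [hn, hsp.start_eq m _ ht] at hc
  refine Does.seq (t₂ := 20 * wordSize n + 49) hc ?_ (by omega)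
  rintro m₁ ⟨h1, h2⟩
  refine Does.seq (t₁ := 5 * wordSize n + 8) (t₂ := 15 * wordSize n + 40)
    (Q := fun m' => m' = setAt m₁ 9 0 s) (Does.writeAt (k := 0) (v := s) rfl ?_ ?_ rfl) ?_
    (by omega)
  · simpa [reg, Expr.eval] using h2
  · simp only [reg, Expr.cost, Expr.eval, h2, Nat.size_zero]
    omega
  rintro _ rfl
  have h2' : setAt m₁ 9 0 s (11 + 0) 0 = s := by rw [setAt_of_ne (by simp), h2]
  refine Does.seq (t₁ := 5 * wordSize n + 20) (t₂ := 12)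
    (Q := fun m' => m' = setAt (setAt m₁ 9 0 s) 10 s 1)
    (Does.writeAt (k := s) (v := 1) ?_ rfl ?_ rfl) ?_ (by omega)
  · simpa [reg, Expr.eval] using h2'
  · simp only [reg, Expr.cost, Expr.eval, h2', Nat.size_zero, Nat.size_one]
    omega
  rintro _ rfl
  refine Does.writeAt (k := 0) (v := 1) rfl rfl ?_ ?_
  · simp [Expr.cost]
  have hz' : ∀ a, 5 ≤ a → a < 11 → ∀ k, m₁ a k = 0 := fun a ha ha' k => by
    rw [h1 a ha', hz a ha]
  refine ⟨ht.congr ?_ ?_ ?_ ?_, ?_, by simp, by simpa using hsp.start_mem, ?_, ?_, ?_, ?_⟩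
  · rw [setAt_of_ne (by simp), setAt_of_ne (by simp), setAt_of_ne (by simp), h1 _ (by simp)]
  · rw [setAt_of_ne (by simp), setAt_of_ne (by simp), setAt_of_ne (by simp), h1 _ (by simp)]
  · rw [setAt_of_ne (by simp), setAt_of_ne (by simp), setAt_of_ne (by simp), h1 _ (by simp)]
  · rw [setAt_of_ne (by simp), setAt_of_ne (by simp), setAt_of_ne (by simp), h1 _ (by simp)]
  · refine size_setAt_le (size_setAt_le (size_setAt_le (fun a ha k => ?_) hss) ?_) ?_
    · rw [h1 a ha]
      exact hsz a ha k
    · simpa using h1S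
    · simpa using h1S
  · simp [setAt, hz' 7]
  · simp [setAt]
  · intro i hi
    obtain rfl : i = 0 := by simpa using hi
    simp [setAt]
  · intro x
    by_cases hx : x = s
    · simp [setAt, hx]
    · simp [setAt, hx, hz' 10]

theorem does_popNode (hsp : TraversalSpec start next out n A C s nb o)
    (hwf : out.wf [] 0 = true) {Q : List ℕ} {h : ℕ} {m : Memory} (hi : TraversalInv n A C Q h m)
    (hh : h < Q.length) :
    Does (popNode out) m (out.time n (wordSize n) + 30 * wordSize n + 50)
      (fun m' => TraversalInv n A C Q (h + 1) m' ∧ m' 5 0 = Q[h] ∧ m' 6 0 = 0 ∧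
        m' 11 0 = o Q[h]) := by
  have hxC : Q[h] ∈ C := hi.mem _ (List.getElem_mem hh)
  have hxs := hsp.size_le hxC
  have hx : m 9 h = Q[h] := by
    have := hi.queue_eq h hh
    rw [List.getElem?_eq_getElem hh] at this
    exact (Option.some.inj this).symm
  have hlen := length_le_two_pow hi.nodup fun x hx => hsp.lt x (hi.mem x hx)
  have hSn := sq_lt_wordSize n
  have hhs : h.size ≤ wordSize n := (size_le_of_le_two_pow (by omega)).trans hSn
  have hhs1 : (h + 1).size ≤ wordSize n :=
    (size_le_of_le_two_pow (show h + 1 ≤ 2 ^ (n * n) by omega)).trans hSn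
  generalize Q[h] = x at *
  refine Does.seq (t₁ := 10 * wordSize n + 10)
    (t₂ := out.time n (wordSize n) + 20 * wordSize n + 39)
    (Q := fun m' => m' = setAt m 5 0 x) (Does.writeAt (k := 0) (v := x) rfl ?_ ?_ rfl) ?_
    (by omega)
  · simp [cell, Expr.eval, hi.head_eq, hx]
  · simp only [cell, Expr.cost, Expr.eval, hi.head_eq, hx, Nat.size_zero]
    omega
  rintro _ rfl
  have h7 : setAt m 5 0 x 7 0 = h := by rw [setAt_of_ne (by simp), hi.head_eq]
  refine Does.seq (t₁ := 10 * wordSize n + 20)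
    (t₂ := out.time n (wordSize n) + 10)
    (Q := fun m' => m' = setAt (setAt m 5 0 x) 7 0 (h + 1))
    (Does.writeAt (k := 0) (v := h + 1) rfl ?_ ?_ rfl) ?_ (by omega)
  · simp [cell, Expr.eval, h7, BinOp.apply_add]
  · simp only [cell, Expr.cost, Expr.eval, h7, Nat.size_zero, Nat.size_one, BinOp.apply_add]
    omega
  rintro _ rfl
  refine Does.seq (t₁ := 5) (t₂ := out.time n (wordSize n))
    (Q := fun m' => m' = setAt (setAt (setAt m 5 0 x) 7 0 (h + 1)) 6 0 0)
    (Does.writeAt (k := 0) (v := 0) rfl rfl ?_ rfl) ?_ (by omega)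
  · simp [Expr.cost]
  rintro _ rfl
  set m₃ := setAt (setAt (setAt m 5 0 x) 7 0 (h + 1)) 6 0 0 with hm₃
  have hsz : ∀ a < 11, ∀ k, (m₃ a k).size ≤ wordSize n :=
    size_setAt_le (size_setAt_le (size_setAt_le hi.size_le hxs) hhs1) (by simp)
  have hne : ∀ a, a ≠ 5 → a ≠ 6 → a ≠ 7 → m₃ a = m a := fun a h5 h6 h7 => by
    rw [hm₃, setAt_of_ne h6, setAt_of_ne h7, setAt_of_ne h5]
  have hinv : TraversalInv n A C Q (h + 1) m₃ :=
    { tables := hi.tables.congr (hne 0 (by simp) (by simp) (by simp))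
        (hne 1 (by simp) (by simp) (by simp)) (hne 2 (by simp) (by simp) (by simp))
        (hne 4 (by simp) (by simp) (by simp))
      size_le := hsz
      nodup := hi.nodup
      mem := hi.mem
      head_eq := by simp [hm₃, setAt]
      tail_eq := by rw [hne 8 (by simp) (by simp) (by simp), hi.tail_eq]
      queue_eq := by rw [hne 9 (by simp) (by simp) (by simp)]; exact hi.queue_eq
      mark_eq := by rw [hne 10 (by simp) (by simp) (by simp)]; exact hi.mark_eq }
  have h5 : m₃ 5 0 = x := by simp [hm₃, setAt]
  have hc := LoopExpr.does_compile (hinv.tables.bounded hsz) out [] 0 (fun _ => 0) m₃ hwf (by simp)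
    (fun _ _ => rfl)
  rw [hinv.tables.size_eq, hsp.out_eq m₃ _ hinv.tables (by rwa [h5]), h5] at hc
  refine hc.mono le_rfl fun m' hm' => ⟨hinv.congr (fun a ha _ _ => hm'.1 a ha) ?_, ?_, ?_, hm'.2⟩
  · intro a ha
    rw [hm'.1 a ha]
    exact hsz a ha
  · rw [hm'.1 5 (by simp), h5]
  · rw [hm'.1 6 (by simp)]
    simp [hm₃, setAt]

/-- Array `10` is the characteristic function of `Q`, so a single look-up keeps `Q` free of
duplicates. That `Q` is a prefix of `Q'` means that the nodes already taken from the queue keep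
their positions. -/
theorem does_pushNode (hsp : TraversalSpec start next out n A C s nb o)
    (hwf : next.wf [] 0 = true) {Q : List ℕ} {h : ℕ} {m : Memory} (hi : TraversalInv n A C Q h m)
    {x k : ℕ} (hx : x ∈ C) (hk : k < n * n) (h5 : m 5 0 = x) (h6 : m 6 0 = k) :
    Does (pushNode next) m (next.time n (wordSize n) + 50 * wordSize n + 80)
      (fun m' => ∃ Q', Q <+: Q' ∧ TraversalInv n A C Q' h m' ∧ m' 5 0 = x ∧ m' 6 0 = k + 1 ∧
        nb x k ∈ Q') := by
  have hyC : nb x k ∈ C := hsp.next_mem x hx k hk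
  have hys := hsp.size_le hyC
  have hSn := sq_lt_wordSize n
  have hks : k.size ≤ wordSize n := size_le_of_le (by omega)
  have hks1 : (k + 1).size ≤ wordSize n := size_le_of_le (by omega)
  have hc := LoopExpr.does_compile (hi.tables.bounded hi.size_le) next [] 0 (fun _ => 0) m hwf
    (by simp) (fun _ _ => rfl)
  rw [hi.tables.size_eq, hsp.next_eq m _ hi.tables (by rwa [h5]) (by rwa [h6]), h5, h6] at hc
  generalize nb x k = y at *
  refine Does.seq (t₂ := 50 * wordSize n + 79) hc ?_ (by omega)
  rintro m₁ ⟨h1, h2⟩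
  have hi₁ : TraversalInv n A C Q h m₁ := hi.congr (fun a ha _ _ => h1 a ha) (fun a ha => by
    rw [h1 a ha]; exact hi.size_le a ha)
  have h5₁ : m₁ 5 0 = x := by rw [h1 5 (by simp), h5]
  have h6₁ : m₁ 6 0 = k := by rw [h1 6 (by simp), h6]
  have hmy := hi₁.mark_eq y
  have hmys : (m₁ 10 y).size ≤ 1 := by rw [hmy]; exact size_ite_le _
  refine Does.seq (t₁ := 40 * wordSize n + 58) (t₂ := 10 * wordSize n + 20)
    (Q := fun m' => ∃ Q', Q <+: Q' ∧ TraversalInv n A C Q' h m' ∧ m' 5 0 = x ∧ m' 6 0 = k ∧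
        y ∈ Q') (Does.ite (t' := 30 * wordSize n + 45) (fun hne => ?_) (fun heq => ?_) ?_) ?_
    (by omega)
  · refine Does.skip ⟨Q, List.prefix_refl _, hi₁, h5₁, h6₁, ?_⟩ (by omega)
    by_contra hyQ
    simp only [reg, Expr.eval, h2] at hne
    simp [hmy, hyQ] at hne
  · have hyQ : y ∉ Q := by
      intro hyQ
      simp only [reg, Expr.eval, h2] at heq
      simp [hmy, hyQ] at heq
    have hnd : (Q ++ [y]).Nodup := by
      rw [List.nodup_append]
      refine ⟨hi₁.nodup, by simp, ?_⟩
      rintro a ha b hb rfl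
      exact hyQ (by simp_all)
    have hmem : ∀ z ∈ Q ++ [y], z ∈ C := by
      intro z hz
      rcases List.mem_append.1 hz with hz | hz
      · exact hi₁.mem z hz
      · rw [List.mem_singleton.1 hz]; exact hyC
    have hlen := length_le_two_pow hnd fun z hz => hsp.lt z (hmem z hz)
    rw [List.length_append, List.length_singleton] at hlen
    have hls : Q.length.size ≤ wordSize n := (size_le_of_le_two_pow (by omega)).trans hSn
    have hls1 : (Q.length + 1).size ≤ wordSize n := (size_le_of_le_two_pow hlen).trans hSn
    refine Does.seq (t₁ := 5 * wordSize n + 10) (t₂ := 25 * wordSize n + 34)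
      (Q := fun m' => m' = setAt m₁ 10 y 1) (Does.writeAt (k := y) (v := 1) ?_ rfl ?_ rfl) ?_
      (by omega)
    · simpa [reg, Expr.eval] using h2
    · simp only [reg, Expr.cost, Expr.eval, h2, Nat.size_zero, Nat.size_one]
      omega
    rintro _ rfl
    have h2' : setAt m₁ 10 y 1 (11 + 0) 0 = y := by rw [setAt_of_ne (by simp), h2]
    have h8' : setAt m₁ 10 y 1 8 0 = Q.length := by rw [setAt_of_ne (by simp), hi₁.tail_eq]
    refine Does.seq (t₁ := 10 * wordSize n + 10) (t₂ := 15 * wordSize n + 20)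
      (Q := fun m' => m' = setAt (setAt m₁ 10 y 1) 9 Q.length y)
      (Does.writeAt (k := Q.length) (v := y) ?_ ?_ ?_ rfl) ?_ (by omega)
    · simpa [cell, Expr.eval] using h8'
    · simpa [reg, Expr.eval] using h2'
    · simp only [cell, reg, Expr.cost, Expr.eval, h2', h8', Nat.size_zero]
      omega
    rintro _ rfl
    have h8'' : setAt (setAt m₁ 10 y 1) 9 Q.length y 8 0 = Q.length := by
      rw [setAt_of_ne (by simp), h8']
    refine Does.writeAt (k := 0) (v := Q.length + 1) rfl ?_ ?_
      ⟨Q ++ [y], List.prefix_append _ _, ?_, ?_, ?_, by simp⟩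
    · simp [cell, Expr.eval, h8'', BinOp.apply_add]
    · simp only [cell, Expr.cost, Expr.eval, h8'', Nat.size_zero, Nat.size_one, BinOp.apply_add]
      omega
    · have hne : ∀ a, a ≠ 8 → a ≠ 9 → a ≠ 10 →
          setAt (setAt (setAt m₁ 10 y 1) 9 Q.length y) 8 0 (Q.length + 1) a = m₁ a :=
        fun a h8 h9 h10 => by rw [setAt_of_ne h8, setAt_of_ne h9, setAt_of_ne h10]
      refine ⟨hi₁.tables.congr (hne 0 (by simp) (by simp) (by simp))
        (hne 1 (by simp) (by simp) (by simp)) (hne 2 (by simp) (by simp) (by simp))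
        (hne 4 (by simp) (by simp) (by simp)), ?_, hnd, hmem, ?_, ?_, ?_, ?_⟩
      · exact size_setAt_le (size_setAt_le (size_setAt_le hi₁.size_le
          (by simp [wordSize])) hys) hls1
      · rw [hne 7 (by simp) (by simp) (by simp), hi₁.head_eq]
      · simp [setAt]
      · intro i hi'
        rw [List.length_append, List.length_singleton] at hi'
        by_cases hiQ : i = Q.length
        · simp [setAt, hiQ]
        · rw [List.getElem?_append_left (by omega), hi₁.queue_eq i (by omega)]
          simp [setAt, hiQ]
      · intro z
        by_cases hzy : z = y
        · simp [setAt, hzy]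
        · simp [setAt, hzy, hi₁.mark_eq z]
    · simp [setAt, h5₁]
    · simp [setAt, h6₁]
  · simp only [reg, Expr.cost, Expr.eval, h2, Nat.size_zero]
    omega
  rintro m₂ ⟨Q', hpre, hi₂, h5₂, h6₂, hy⟩
  refine Does.writeAt (k := 0) (v := k + 1) rfl ?_ ?_ ⟨Q', hpre, hi₂.congr ?_ ?_, ?_, ?_, hy⟩
  · simp [cell, Expr.eval, h6₂, BinOp.apply_add]
  · simp only [cell, Expr.cost, Expr.eval, h6₂, Nat.size_zero, Nat.size_one, BinOp.apply_add]
    omega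
  · intro a _ _ ha
    rw [setAt_of_ne ha]
  · exact size_setAt_le hi₂.size_le hks1
  · rw [setAt_of_ne (by simp), h5₂]
  · simp [setAt]

/-- A bound for the time of `pushNodes`. -/
def pushTime (next : LoopExpr) (n : ℕ) : ℕ :=
  n * n * ((20 * wordSize n + 30) + 1 + (next.time n (wordSize n) + 50 * wordSize n + 80)) +
    (20 * wordSize n + 30) + 1

theorem does_pushNodes (hsp : TraversalSpec start next out n A C s nb o)
    (hwf : next.wf [] 0 = true) {Q : List ℕ} {h : ℕ} {m : Memory} (hi : TraversalInv n A C Q h m)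
    {x : ℕ} (hx : x ∈ C) (h5 : m 5 0 = x) (h6 : m 6 0 = 0) :
    Does (pushNodes next) m (pushTime next n)
      (fun m' => ∃ Q', Q <+: Q' ∧ TraversalInv n A C Q' h m' ∧ ∀ k < n * n, nb x k ∈ Q') := by
  have hSn := sq_lt_wordSize n
  have hns : n.size ≤ wordSize n := by
    rw [← hi.tables.size_eq]
    exact (hi.size_le 0 (by simp) 0).trans (by rw [hi.tables.size_eq])
  have hnns : (n * n).size ≤ wordSize n := size_le_of_le (by omega)
  refine (Does.loop (I := fun i m' => ∃ Q', Q <+: Q' ∧ TraversalInv n A C Q' h m' ∧ m' 5 0 = x ∧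
    m' 6 0 = i ∧ ∀ k < i, nb x k ∈ Q') (k := n * n) ?_ ?_
    ⟨Q, List.prefix_refl _, hi, h5, h6, by simp⟩).mono le_rfl ?_
  · rintro i hin m₁ ⟨Q₁, hpre, hi₁, h5₁, h6₁, hQ₁⟩
    have h0 := hi₁.tables.size_eq
    have his : i.size ≤ wordSize n := size_le_of_le (by omega)
    refine ⟨?_, ?_, ?_⟩
    · simp [cell, Expr.eval, h6₁, h0, BinOp.apply_lt, BinOp.apply_mul, hin]
    · simp only [cell, Expr.eval, Expr.cost, h6₁, h0, BinOp.apply_lt, BinOp.apply_mul, if_pos hin,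
        Nat.size_zero, Nat.size_one]
      omega
    · refine (does_pushNode hsp hwf hi₁ hx hin h5₁ h6₁).mono le_rfl ?_
      rintro m₂ ⟨Q₂, hpre₂, hi₂, h5₂, h6₂, hy⟩
      refine ⟨Q₂, hpre.trans hpre₂, hi₂, h5₂, h6₂, fun k hk => ?_⟩
      by_cases hki : k = i
      · rwa [hki]
      · exact hpre₂.subset (hQ₁ k (by omega))
  · rintro m₁ ⟨Q₁, hpre, hi₁, h5₁, h6₁, hQ₁⟩
    have h0 := hi₁.tables.size_eq
    refine ⟨?_, ?_⟩
    · simp [cell, Expr.eval, h6₁, h0, BinOp.apply_lt, BinOp.apply_mul]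
    · simp only [cell, Expr.eval, Expr.cost, h6₁, h0, BinOp.apply_lt, BinOp.apply_mul, lt_irrefl,
        if_false, Nat.size_zero]
      omega
  · rintro m₁ ⟨Q₁, hpre, hi₁, h5₁, h6₁, hQ₁⟩
    exact ⟨Q₁, hpre, hi₁, hQ₁⟩

end

end RAM

/-! ### The main loop and its delays -/

namespace RAM

section

variable {start next out : LoopExpr} {n : ℕ} {A : ℕ → ℕ} {C : Set ℕ} {s : ℕ} {nb : ℕ → ℕ → ℕ}
  {o : ℕ → ℕ}

/-- Each pass takes a new node, and there are at most `2 ^ (n * n)` nodes, so `r` bounds the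
remaining passes. All neighbours of the nodes already taken are in `Q`; when the queue is exhausted,
`Q` is closed. The time `acc` since the last output is at most `a` at the start of each pass: the
only work between an output and the next pass is `pushNodes`. -/
theorem runs_mainLoop (hsp : TraversalSpec start next out n A C s nb o)
    (hwfn : next.wf [] 0 = true) (hwfo : out.wf [] 0 = true) {a : ℕ} (ha : pushTime next n ≤ a)
    (r : ℕ) : ∀ (Q : List ℕ) (h : ℕ) (m : Memory), TraversalInv n A C Q h m → h ≤ Q.length →
      2 ^ (n * n) ≤ h + r → (∀ x ∈ Q.take h, ∀ k < n * n, nb x k ∈ Q) →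
      ∃ (l : List (ℕ × Option ℕ)) (Q' : List ℕ) (m' : Memory),
        Runs ⟨[mainLoop next out], m⟩ l ⟨[], m'⟩ ∧ Q <+: Q' ∧ Q'.Nodup ∧ (∀ x ∈ Q', x ∈ C) ∧
        (∀ x ∈ Q', ∀ k < n * n, nb x k ∈ Q') ∧ outputs l = (Q'.drop h).map o ∧
        ∀ acc ≤ a, ∀ d ∈ delays acc l,
          d ≤ a + (out.time n (wordSize n) + 60 * wordSize n + 100) := by
  have hSn := sq_lt_wordSize n
  have hend : ∀ (Q : List ℕ) (m : Memory), TraversalInv n A C Q Q.length m →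
      (∀ x ∈ Q.take Q.length, ∀ k < n * n, nb x k ∈ Q) →
      ∃ (l : List (ℕ × Option ℕ)) (Q' : List ℕ) (m' : Memory),
        Runs ⟨[mainLoop next out], m⟩ l ⟨[], m'⟩ ∧ Q <+: Q' ∧ Q'.Nodup ∧ (∀ x ∈ Q', x ∈ C) ∧
        (∀ x ∈ Q', ∀ k < n * n, nb x k ∈ Q') ∧ outputs l = (Q'.drop Q.length).map o ∧
        ∀ acc ≤ a, ∀ d ∈ delays acc l,
          d ≤ a + (out.time n (wordSize n) + 60 * wordSize n + 100) := by
    intro Q m hi hclosed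
    have hlen := length_le_two_pow hi.nodup fun x hx => hsp.lt x (hi.mem x hx)
    have hls : Q.length.size ≤ wordSize n := (size_le_of_le_two_pow hlen).trans hSn
    have hev : (Expr.op .lt (cell 7) (cell 8)).eval m = 0 := by
      simp [cell, Expr.eval, hi.head_eq, hi.tail_eq, BinOp.apply_lt]
    refine ⟨[((Expr.op .lt (cell 7) (cell 8)).cost m + 1, none)], Q, m, ⟨?_, rfl⟩,
      List.prefix_refl _, hi.nodup, hi.mem, by simpa using hclosed, by simp [outputs], ?_⟩
    · simp [mainLoop, step, hev]
    · intro acc hacc d hd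
      simp only [delays, List.mem_singleton] at hd
      subst hd
      simp only [cell, Expr.eval, Expr.cost, hi.head_eq, hi.tail_eq, BinOp.apply_lt, lt_irrefl,
        if_false, Nat.size_zero]
      omega
  induction r with
  | zero =>
    intro Q h m hi hle hr hclosed
    have hlen := length_le_two_pow hi.nodup fun x hx => hsp.lt x (hi.mem x hx)
    obtain rfl : h = Q.length := by omega
    exact hend Q m hi hclosed
  | succ r ih =>
    intro Q h m hi hle hr hclosed
    have hlen := length_le_two_pow hi.nodup fun x hx => hsp.lt x (hi.mem x hx)
    have hls : Q.length.size ≤ wordSize n := (size_le_of_le_two_pow (by omega)).trans hSn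
    have hhs : h.size ≤ wordSize n := (size_le_of_le_two_pow (by omega)).trans hSn
    rcases hle.eq_or_lt with rfl | hlt
    · exact hend Q m hi hclosed
    have hev : (Expr.op .lt (cell 7) (cell 8)).eval m ≠ 0 := by
      simp [cell, Expr.eval, hi.head_eq, hi.tail_eq, BinOp.apply_lt, hlt]
    have hcost : (Expr.op .lt (cell 7) (cell 8)).cost m ≤ 6 * wordSize n + 10 := by
      simp only [cell, Expr.eval, Expr.cost, hi.head_eq, hi.tail_eq, BinOp.apply_lt, if_pos hlt,
        Nat.size_zero, Nat.size_one]
      omega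
    have hxC : Q[h] ∈ C := hi.mem _ (List.getElem_mem hlt)
    obtain ⟨m₁, ⟨hi₁, h5, h6, h11⟩, hrun₁⟩ := does_popNode hsp hwfo hi hlt
    obtain ⟨m₂, ⟨Q₂, hpre, hi₂, hnb⟩, hrun₂⟩ := does_pushNodes hsp hwfn hi₁ hxC h5 h6
    -- The first `h + 1` nodes are not changed by appending, so closedness only has to be added for
    -- `Q[h]`.
    have htake : Q₂.take (h + 1) = Q.take h ++ [Q[h]] := by
      obtain ⟨t, rfl⟩ := hpre
      rw [List.take_append_of_le_length (by omega), List.take_succ_eq_append_getElem hlt]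
    obtain ⟨l₃, Q₃, m₃, hrun₃, hpre₃, hnd₃, hmem₃, hcl₃, hout₃, hdel₃⟩ := ih Q₂ (h + 1) m₂ hi₂
      (by have := hpre.length_le; omega) (by omega) (by
        rw [htake]
        intro x hx k hk
        rcases List.mem_append.1 hx with hx | hx
        · exact hpre.subset (hclosed x hx k hk)
        · rw [List.mem_singleton.1 hx]
          exact hnb k hk)
    obtain ⟨l₁, hl₁, hs₁, ht₁⟩ := hrun₁ [.seq (.emit (reg 0)) (pushNodes next), mainLoop next out]
    obtain ⟨l₂, hl₂, hs₂, ht₂⟩ := hrun₂ [mainLoop next out]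
    have hstep : step ⟨[mainLoop next out], m⟩ =
        ⟨.seq (popNode out) (.seq (.emit (reg 0)) (pushNodes next)) :: [mainLoop next out], m⟩ := by
      simp only [mainLoop, step, if_pos hev]
    have hreg : (reg 0).eval m₁ = o Q[h] := by simpa [reg, Expr.eval] using h11
    have hos : (o Q[h]).size ≤ wordSize n :=
      (size_le_of_le_two_pow (hsp.out_lt _ hxC).le).trans hSn
    have hrun := Runs.cons (c := ⟨[mainLoop next out], m⟩) (by
      rw [hstep]
      exact Runs.cons (hl₁.trans (Runs.cons
        (c := ⟨.seq (.emit (reg 0)) (pushNodes next) :: [mainLoop next out], m₁⟩)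
        (Runs.cons (c := ⟨.emit (reg 0) :: pushNodes next :: [mainLoop next out], m₁⟩)
          (hl₂.trans hrun₃)))))
    simp only [stepCost, stepOutput, mainLoop, hreg] at hrun
    refine ⟨_, Q₃, m₃, hrun, hpre.trans hpre₃, hnd₃, hmem₃, hcl₃, ?_, ?_⟩
    · have hdrop : Q₃.drop h = Q[h] :: Q₃.drop (h + 1) := by
        obtain ⟨t, rfl⟩ := hpre.trans hpre₃
        rw [List.drop_eq_getElem_cons (by rw [List.length_append]; omega),
          List.getElem_append_left hlt]
      have e₁ := outputs_of_silent hs₁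
      have e₂ := outputs_of_silent hs₂
      unfold outputs at *
      simp [e₁, e₂, hout₃, hdrop]
    · intro acc hacc d hd
      simp only [delays] at hd
      rw [delays_append_of_silent _ _ hs₁] at hd
      simp only [delays, List.mem_cons] at hd
      rw [delays_append_of_silent _ _ hs₂] at hd
      rcases hd with rfl | hd
      · have : (reg 0).cost m₁ ≤ 2 * wordSize n + 2 := by
          have h11' : m₁ (11 + 0) 0 = o Q[h] := h11
          simp only [reg, Expr.cost, Expr.eval, h11', Nat.size_zero]
          omega
        omega
      · exact hdel₃ _ (by omega) d hd

/-- A bound for the delays of `traversal`. -/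
def delayBound (start next out : LoopExpr) (n : ℕ) : ℕ :=
  (((n + 1) * (n + 1)) * (70 * wordSize n + 120) + 60 * wordSize n + 100) +
    (start.time n (wordSize n) + 20 * wordSize n + 50) + 2 + pushTime next n +
    (out.time n (wordSize n) + 60 * wordSize n + 100)

theorem polyBounded_delayBound (start next out : LoopExpr) :
    PolyBounded (delayBound start next out) := by
  have hc := PolyBounded.const
  have hS := polyBounded_wordSize
  have hn1 := PolyBounded.id.add (hc 1)
  have h60 : PolyBounded fun n => 60 * wordSize n := (hc 60).mul hS
  have hpush : PolyBounded (pushTime next) :=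
    (((PolyBounded.id.mul PolyBounded.id).mul (((((hc 20).mul hS).add (hc 30)).add (hc 1)).add
      (((next.polyBounded_time hS).add ((hc 50).mul hS)).add (hc 80)))).add
      (((hc 20).mul hS).add (hc 30))).add (hc 1)
  exact (((((((hn1.mul hn1).mul (((hc 70).mul hS).add (hc 120))).add h60).add (hc 100)).add
    (((start.polyBounded_time hS).add ((hc 20).mul hS)).add (hc 50))).add (hc 2)).add hpush).add
    (((out.polyBounded_time hS).add h60).add (hc 100))

theorem runs_traversal (hsp : TraversalSpec start next out n A C s nb o)
    (hwfs : start.wf [] 0 = true) (hwfn : next.wf [] 0 = true) (hwfo : out.wf [] 0 = true)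
    {m : Memory} (h0 : m 0 0 = n) (h0' : ∀ k, k ≠ 0 → m 0 k = 0)
    (h1 : m 1 = A) (hA : ∀ k, A k ≤ 1) (hz : ∀ a, 2 ≤ a → ∀ k, m a k = 0) :
    ∃ (N : ℕ) (Q : List ℕ), (step^[N] ⟨[traversal start next out], m⟩).todo = [] ∧
      outputs (trace N ⟨[traversal start next out], m⟩) = Q.map o ∧ Q.Nodup ∧ s ∈ Q ∧
      (∀ x ∈ Q, x ∈ C) ∧ (∀ x ∈ Q, ∀ k < n * n, nb x k ∈ Q) ∧
      ∀ d ∈ delays 0 (trace N ⟨[traversal start next out], m⟩),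
        d ≤ delayBound start next out n := by
  obtain ⟨m₁, ⟨ht₁, hsz₁, hz₁⟩, hrun₁⟩ := does_initTables h0 h0' h1 hA hz
  obtain ⟨m₂, hi₂, hrun₂⟩ := does_initQueue hsp hwfs ht₁ hsz₁ hz₁
  obtain ⟨l₁, hl₁, hs₁, hc₁⟩ := hrun₁ [.seq (initQueue start) (mainLoop next out)]
  obtain ⟨l₂, hl₂, hs₂, hc₂⟩ := hrun₂ [mainLoop next out]
  -- The allowance `a` covers the initialisation, which counts towards the first delay, as well as
  -- one run of `pushNodes`.
  obtain ⟨l₃, Q, m₃, hrun₃, hpre, hnd, hmem, hcl, hout, hdel⟩ := runs_mainLoop hsp hwfn hwfo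
    (a := (((n + 1) * (n + 1)) * (70 * wordSize n + 120) + 60 * wordSize n + 100) +
      (start.time n (wordSize n) + 20 * wordSize n + 50) + 2 + pushTime next n) (by omega)
    (2 ^ (n * n)) [s] 0 m₂ hi₂ (by simp) (by simp) (by simp)
  have hrun : Runs ⟨[traversal start next out], m⟩
      ((1, none) :: (l₁ ++ ((1, none) :: (l₂ ++ l₃)))) ⟨[], m₃⟩ :=
    Runs.cons (c := ⟨[traversal start next out], m⟩) (hl₁.trans (Runs.cons
      (c := ⟨.seq (initQueue start) (mainLoop next out) :: [], m₁⟩) (hl₂.trans hrun₃)))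
  refine ⟨_, Q, by rw [hrun.1], ?_, hnd, hpre.subset (by simp), hmem, hcl, ?_⟩
  · rw [hrun.2]
    have e₁ := outputs_of_silent hs₁
    have e₂ := outputs_of_silent hs₂
    unfold outputs at *
    simp [e₁, e₂, hout]
  · rw [hrun.2]
    intro d hd
    simp only [delays] at hd
    rw [delays_append_of_silent _ _ hs₁] at hd
    simp only [delays] at hd
    rw [delays_append_of_silent _ _ hs₂] at hd
    exact hdel _ (by omega) d hd

end

end RAM

/-! ### From a traversal to an enumeration -/

theorem graphInput_one_le {n : ℕ} (G : SimpleGraph (Fin n)) (k : ℕ) : graphInput G 1 k ≤ 1 := by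
  unfold graphInput
  simp only [one_ne_zero, false_and, if_false]
  split_ifs <;> simp

/-- A traversal whose nodes represent the graphs in `Sol G`, and in which every set of nodes that
contains the start node and is closed under neighbours represents all graphs in `Sol G`, gives an
enumeration with polynomial delay and exponential space. -/
theorem enumerable_of_traversal
    {Sol : ∀ {n : ℕ}, SimpleGraph (Fin n) → Set (SimpleGraph (Fin n))}
    {start next out : RAM.LoopExpr} (hwfs : start.wf [] 0 = true) (hwfn : next.wf [] 0 = true)
    (hwfo : out.wf [] 0 = true)
    (h : ∀ (n : ℕ) (G : SimpleGraph (Fin n)), ∃ (C : Set ℕ) (s : ℕ) (nb : ℕ → ℕ → ℕ)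
      (g : ℕ → SimpleGraph (Fin n)),
      RAM.TraversalSpec start next out n (graphInput G 1) C s nb (fun x => graphCode (g x)) ∧
      (∀ x ∈ C, g x ∈ Sol G) ∧ Set.InjOn g C ∧
      ∀ C' ⊆ C, s ∈ C' → (∀ x ∈ C', ∀ k < n * n, nb x k ∈ C') →
        ∀ H ∈ Sol G, ∃ x ∈ C', g x = H) :
    EnumerableWithPolyDelayExpSpace Sol := by
  obtain ⟨p, hp⟩ := RAM.polyBounded_delayBound start next out
  set P := RAM.traversal start next out with hP
  -- The `2` accounts for the input arrays. The bound `D` covers the cost of a step, at most `p n`,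
  -- and the input, whose addresses are below `n * n` and whose contents are at most `n` or `1`.
  set A := max 2 P.arrayBound with hA
  let D : Polynomial ℕ := p + .X * .X + 1
  refine ⟨P, p, .C A + (D + (D + 1)), fun n G => ?_⟩
  obtain ⟨C, s, nb, g, hsp, hSol, hinj, hall⟩ := h n G
  obtain ⟨N, Q, h1, h2, h3, h4, h5, h6, h7⟩ := RAM.runs_traversal hsp hwfs hwfn hwfo
    (m := graphInput G) (by simp [graphInput])
    (fun k hk => by simp [graphInput, hk]) rfl (graphInput_one_le G)
    (fun a ha k => by
      have : a ≠ 0 := by omega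
      have : a ≠ 1 := by omega
      simp [graphInput, *])
  have hdel : ∀ d ∈ RAM.delays 0 (RAM.trace N ⟨[P], graphInput G⟩), d ≤ p.eval n :=
    fun d hd => (h7 d hd).trans (hp n)
  refine ⟨N, Q.map g, h1, ?_, ?_, ?_, hdel, ?_⟩
  · rw [h2, List.map_map]
    rfl
  · exact (List.nodup_map_iff_inj_on h3).2 fun x hx y hy hxy => hinj (h5 x hx) (h5 y hy) hxy
  · intro H
    rw [List.mem_map]
    constructor
    · rintro ⟨x, hx, rfl⟩
      exact hSol x (h5 x hx)
    · intro hH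
      exact hall {x | x ∈ Q} (fun x hx => h5 x hx) h4 (fun x hx => h6 x hx) H hH
  · intro k hk
    have hD : D.eval n = p.eval n + n * n + 1 := by simp [D]
    have hsmall : RAM.SmallMemory A (D.eval n) (graphInput G) := by
      intro a k hak
      unfold graphInput at hak ⊢
      split_ifs at hak ⊢ with ha ha'
      · refine ⟨by omega, ?_, RAM.size_le_of_le (by rw [hD]; nlinarith)⟩
        rw [ha.2]
        simp
      · obtain ⟨rfl, i, j, rfl, -⟩ := ha'
        refine ⟨by omega, RAM.size_le_of_le ?_, by rw [hD, Nat.size_one]; omega⟩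
        have hi : n * (i : ℕ) + n ≤ n * n := by
          rw [← Nat.mul_succ]
          exact Nat.mul_le_mul_left _ i.isLt
        have hj := j.isLt
        rw [hD]
        omega
      · exact absurd rfl hak
    have := (RAM.smallMemory_iterate N ⟨[P], graphInput G⟩ hsmall
      (by simp [hA]) (fun x hx => ((RAM.cost_le_of_delays_le _ 0 hdel).2 x hx).trans
        (by rw [hD]; omega)) k hk).fitsIn
    simpa using this

/-! ### Codes of graphs -/

open RAM (iter)

section Codes

variable {n : ℕ}

open Classical in
/-- The indicator of a proposition. -/
noncomputable def ind (p : Prop) : ℕ := if p then 1 else 0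

theorem ind_le_one (p : Prop) : ind p ≤ 1 := by unfold ind; split_ifs <;> simp

theorem ind_of_true {p : Prop} (h : p) : ind p = 1 := if_pos h

theorem ind_of_false {p : Prop} (h : ¬ p) : ind p = 0 := if_neg h

theorem ind_mul (p q : Prop) : ind p * ind q = ind (p ∧ q) := by
  by_cases hp : p <;> by_cases hq : q <;> simp [ind, hp, hq]

theorem one_sub_ind (p : Prop) : 1 - ind p = ind (¬ p) := by
  by_cases hp : p <;> simp [ind, hp]

theorem ind_add_pos (p q : Prop) : (if 0 < ind p + ind q then 1 else 0) = ind (p ∨ q) := by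
  by_cases hp : p <;> by_cases hq : q <;> simp [ind, hp, hq]

open Classical in
/-- The positions of the digits `1` in the code of a graph. -/
noncomputable def codePositions (H : SimpleGraph (Fin n)) : Finset ℕ :=
  (Finset.univ.filter (fun e : Fin n × Fin n => H.Adj e.1 e.2)).image
    (fun e => n * (e.1 : ℕ) + (e.2 : ℕ))

theorem pos_injective : Function.Injective (fun e : Fin n × Fin n => n * (e.1 : ℕ) + (e.2 : ℕ)) := by
  intro e f h
  apply (finProdFinEquiv (m := n) (n := n)).injective
  apply Fin.ext
  simp only [finProdFinEquiv_apply_val]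
  simp only at h
  omega

theorem pos_lt (u v : Fin n) : n * (u : ℕ) + v < n * n := by
  have hu : n * (u : ℕ) + n ≤ n * n := by
    rw [← Nat.mul_succ]
    exact Nat.mul_le_mul_left _ u.isLt
  have hv := v.isLt
  omega

theorem pos_mem_codePositions {H : SimpleGraph (Fin n)} {u v : Fin n} :
    n * (u : ℕ) + v ∈ codePositions H ↔ H.Adj u v := by
  classical
  unfold codePositions
  rw [Finset.mem_image]
  constructor
  · rintro ⟨e, he, heq⟩
    obtain rfl := pos_injective (a₁ := e) (a₂ := (u, v)) heq
    simpa using he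
  · intro h
    exact ⟨(u, v), by simpa using h, rfl⟩

theorem graphCode_eq_sum_codePositions (H : SimpleGraph (Fin n)) :
    graphCode H = ∑ k ∈ codePositions H, 2 ^ k := by
  classical
  unfold codePositions graphCode
  rw [Finset.sum_image fun e _ f _ h => pos_injective h]

theorem graphCode_lt (H : SimpleGraph (Fin n)) : graphCode H < 2 ^ (n * n) := by
  rw [graphCode_eq_sum_codePositions]
  refine Nat.geomSum_lt le_rfl fun k hk => ?_
  unfold codePositions at hk
  obtain ⟨e, -, rfl⟩ := Finset.mem_image.1 hk
  exact pos_lt e.1 e.2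

theorem graphCode_div_mod (H : SimpleGraph (Fin n)) (u v : Fin n) :
    graphCode H / 2 ^ (n * (u : ℕ) + v) % 2 = ind (H.Adj u v) := by
  have h1 : (graphCode H).testBit (n * (u : ℕ) + v) = true ↔ H.Adj u v := by
    rw [← Nat.mem_bitIndices, ← List.mem_toFinset, graphCode_eq_sum_codePositions,
      Finset.toFinset_bitIndices_sum_two_pow, pos_mem_codePositions]
  rw [Nat.testBit_eq_decide_div_mod_eq, decide_eq_true_eq] at h1
  by_cases h : H.Adj u v
  · rw [ind_of_true h, h1.2 h]
  · rw [ind_of_false h]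
    have := mt h1.1 h
    omega

theorem graphCode_eq_sum (H : SimpleGraph (Fin n)) :
    graphCode H = ∑ u : Fin n, ∑ v : Fin n, ind (H.Adj u v) * 2 ^ (n * (u : ℕ) + v) := by
  classical
  unfold graphCode
  rw [Finset.sum_filter, Fintype.sum_prod_type]
  refine Finset.sum_congr rfl fun u _ => Finset.sum_congr rfl fun v _ => ?_
  by_cases h : H.Adj u v <;> simp [ind, h]

theorem graphCode_bot : graphCode (⊥ : SimpleGraph (Fin n)) = 0 := by
  simp [graphCode_eq_sum, ind]

/-- The edge occupies the two distinct entries `(u, v)` and `(v, u)`, both zero in `H`, so addition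
of the two powers sets these digits without carries. -/
theorem graphCode_sup_edge {H : SimpleGraph (Fin n)} {u v : Fin n} (huv : u ≠ v)
    (h : ¬ H.Adj u v) : graphCode (H ⊔ SimpleGraph.edge u v) =
      graphCode H + 2 ^ (n * (u : ℕ) + v) + 2 ^ (n * (v : ℕ) + u) := by
  classical
  have h' : ¬ H.Adj v u := fun h' => h h'.symm
  have key : ∀ a b : Fin n, ind ((H ⊔ SimpleGraph.edge u v).Adj a b) * 2 ^ (n * (a : ℕ) + b) =
      ind (H.Adj a b) * 2 ^ (n * (a : ℕ) + b) +
      (if a = u then if b = v then 2 ^ (n * (u : ℕ) + v) else 0 else 0) +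
      (if a = v then if b = u then 2 ^ (n * (v : ℕ) + u) else 0 else 0) := by
    intro a b
    have hadj : (H ⊔ SimpleGraph.edge u v).Adj a b ↔
        H.Adj a b ∨ (a = u ∧ b = v) ∨ (a = v ∧ b = u) := by
      rw [SimpleGraph.sup_adj, SimpleGraph.edge_adj]
      constructor
      · rintro (h | ⟨h, -⟩)
        · exact .inl h
        · exact .inr (by tauto)
      · rintro (h | ⟨rfl, rfl⟩ | ⟨rfl, rfl⟩)
        exacts [.inl h, .inr ⟨by simp, huv⟩, .inr ⟨by simp, huv.symm⟩]
    by_cases h1 : a = u ∧ b = v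
    · obtain ⟨rfl, rfl⟩ := h1
      rw [ind_of_true (hadj.2 (by simp)), ind_of_false h]
      simp [huv]
    by_cases h2 : a = v ∧ b = u
    · obtain ⟨rfl, rfl⟩ := h2
      rw [ind_of_true (hadj.2 (by simp)), ind_of_false h']
      simp [huv.symm]
    have h3 : (H ⊔ SimpleGraph.edge u v).Adj a b = H.Adj a b := by
      apply propext
      rw [hadj]
      tauto
    rw [h3]
    have e1 : (if a = u then if b = v then 2 ^ (n * (u : ℕ) + v) else 0 else 0) = 0 := by
      split_ifs with ha hb
      exacts [absurd ⟨ha, hb⟩ h1, rfl, rfl]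
    have e2 : (if a = v then if b = u then 2 ^ (n * (v : ℕ) + u) else 0 else 0) = 0 := by
      split_ifs with ha hb
      exacts [absurd ⟨ha, hb⟩ h2, rfl, rfl]
    rw [e1, e2, add_zero, add_zero]
  simp only [graphCode_eq_sum, key, Finset.sum_add_distrib]
  simp

end Codes

/-! ### Greedy extension to a minimal threshold deletion -/

theorem iter_induction {α : Type*} {f : ℕ → α → α} {x : α} {n : ℕ} (I : ℕ → α → Prop)
    (h0 : I 0 x) (hs : ∀ i < n, ∀ y, I i y → I (i + 1) (f i y)) : I n (iter f x n) := by
  induction n with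
  | zero => exact h0
  | succ n ih => exact hs n (by omega) _ (ih fun i hi => hs i (by omega))

section Greedy

variable {n : ℕ}

open Classical in
/-- Adds the edge `uv` of `G` to `H` if a threshold graph results. -/
noncomputable def addEdge (G : SimpleGraph (Fin n)) (u v : Fin n) (H : SimpleGraph (Fin n)) :
    SimpleGraph (Fin n) :=
  if G.Adj u v ∧ ¬ H.Adj u v ∧ IsThreshold (H ⊔ SimpleGraph.edge u v) then
    H ⊔ SimpleGraph.edge u v else H

/-- Tries to add each edge of `G` once. -/
noncomputable def addEdges (G H : SimpleGraph (Fin n)) : SimpleGraph (Fin n) :=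
  iter (fun u H => iter (fun v H =>
    if h : u < n ∧ v < n then addEdge G ⟨u, h.1⟩ ⟨v, h.2⟩ H else H) H n) H n

/-- Adds edges of `G` as long as threshold graphs result. -/
noncomputable def greedy (G H : SimpleGraph (Fin n)) : SimpleGraph (Fin n) :=
  iter (fun _ H => iter (fun _ H => addEdges G H) H n) H n

/-- `H` is a threshold graph between `H₀` and `G`, and either it is maximal or it has at least `k`
edges. -/
structure GreedyInv (G H₀ : SimpleGraph (Fin n)) (k : ℕ) (H : SimpleGraph (Fin n)) : Prop where
  le : H₀ ≤ H
  le' : H ≤ G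
  threshold : IsThreshold H
  progress : H ∈ minimalThresholdDeletions G ∨ k ≤ H.edgeSet.ncard

theorem ncard_edgeSet_lt {H K : SimpleGraph (Fin n)} (h : H < K) :
    H.edgeSet.ncard < K.edgeSet.ncard :=
  Set.ncard_lt_ncard (SimpleGraph.edgeSet_ssubset_edgeSet.2 h) (Set.toFinite _)

/-- If a sweep over all pairs adds nothing, every pair has been rejected for the same graph, which
is then maximal by the single-edge criterion; otherwise the number of edges grows. Pairs rejected
early in a sweep may become admissible later, hence the repeated sweeps. -/
theorem greedyInv_addEdges {G H₀ H : SimpleGraph (Fin n)} {k : ℕ} (h : GreedyInv G H₀ k H) :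
    GreedyInv G H₀ (k + 1) (addEdges G H) := by
  let I : ℕ → ℕ → SimpleGraph (Fin n) → Prop := fun i j K =>
    GreedyInv G H₀ k K ∧ (K ∈ minimalThresholdDeletions G ∨ k + 1 ≤ K.edgeSet.ncard ∨
      ∀ u v : Fin n, ((u : ℕ) < i ∨ (u : ℕ) = i ∧ (v : ℕ) < j) → G.Adj u v → ¬ K.Adj u v →
        ¬ IsThreshold (K ⊔ SimpleGraph.edge u v))
  have hstep : ∀ u v : Fin n, ∀ K, I u v K → I u (v + 1) (addEdge G u v K) := by
    rintro u v K ⟨h1, h2⟩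
    unfold addEdge
    split_ifs with hc
    · obtain ⟨hG, hK, ht⟩ := hc
      have hlt : K < K ⊔ SimpleGraph.edge u v := by
        refine lt_of_le_of_ne le_sup_left fun heq => hK ?_
        rw [heq]
        simp [SimpleGraph.edge_adj, hG.ne]
      have hcard := ncard_edgeSet_lt hlt
      -- As an edge can be added, `K` is not maximal, so the invariant yields `k` edges.
      have hk : k ≤ K.edgeSet.ncard := by
        rcases h1.progress with hm | hk
        · exact absurd ht ((mem_minimalThresholdDeletions_iff.1 hm).2.2 u v hG hK)
        · exact hk
      refine ⟨⟨h1.le.trans hlt.le, sup_le h1.le' ?_, ht, .inr (by omega)⟩, .inr (.inl (by omega))⟩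
      intro a b hab
      rw [SimpleGraph.edge_adj] at hab
      rcases hab.1 with ⟨rfl, rfl⟩ | ⟨rfl, rfl⟩
      exacts [hG, hG.symm]
    · refine ⟨h1, h2.imp_right (Or.imp_right fun h3 u' v' huv hG hK ht => ?_)⟩
      by_cases hu : u' = u
      · by_cases hv : v' = v
        · subst hu hv
          exact hc ⟨hG, hK, ht⟩
        · refine h3 u' v' ?_ hG hK ht
          have := Fin.val_ne_of_ne hv
          omega
      · refine h3 u' v' ?_ hG hK ht
        have := Fin.val_ne_of_ne hu
        omega
  have hfin : I n 0 (addEdges G H) := by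
    refine iter_induction (fun i => I i 0) ⟨h, .inr (.inr (by simp))⟩ fun i hi K hK => ?_
    have hrow : I i n (iter (fun v H =>
        if h : i < n ∧ v < n then addEdge G ⟨i, h.1⟩ ⟨v, h.2⟩ H else H) K n) := by
      refine iter_induction (I i) hK fun j hj K' hK' => ?_
      rw [dif_pos ⟨hi, hj⟩]
      exact hstep ⟨i, hi⟩ ⟨j, hj⟩ K' hK'
    refine ⟨hrow.1, hrow.2.imp_right (Or.imp_right fun h3 u v huv => h3 u v ?_)⟩
    have := v.isLt
    omega
  obtain ⟨h1, h2⟩ := hfin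
  refine ⟨h1.le, h1.le', h1.threshold, ?_⟩
  rcases h2 with h2 | h2 | h2
  · exact .inl h2
  · exact .inr h2
  · exact .inl (mem_minimalThresholdDeletions_iff.2 ⟨h1.le', h1.threshold,
      fun u v => h2 u v (.inl u.isLt)⟩)

theorem greedy_spec {G H : SimpleGraph (Fin n)} (hle : H ≤ G) (ht : IsThreshold H) :
    H ≤ greedy G H ∧ greedy G H ∈ minimalThresholdDeletions G := by
  have hinv : GreedyInv G H (n * n) (greedy G H) := by
    refine iter_induction (fun i => GreedyInv G H (n * i)) ⟨le_rfl, hle, ht, .inr (by simp)⟩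
      fun i _ K hK => ?_
    exact iter_induction (fun j => GreedyInv G H (n * i + j)) hK
      fun j _ K' hK' => greedyInv_addEdges hK'
  refine ⟨hinv.le, ?_⟩
  rcases hinv.progress with h | h
  · exact h
  -- After `n * n` sweeps a graph that is not maximal would have `n * n` edges, too many when `n` is
  -- positive. For `n = 0` the bound is vacuous, but so is maximality.
  · rcases Nat.eq_zero_or_pos n with rfl | hn
    · exact mem_minimalThresholdDeletions_iff.2 ⟨hinv.le', hinv.threshold, fun u => u.elim0⟩
    · classical
      have h1 := (greedy G H).card_edgeFinset_le_card_choose_two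
      rw [SimpleGraph.edgeFinset, ← Set.ncard_eq_toFinset_card', Fintype.card_fin, Nat.choose_two_right] at h1
      have h2 : n * (n - 1) / 2 ≤ n * (n - 1) := Nat.div_le_self _ _
      have h3 : n * (n - 1) < n * n := Nat.mul_lt_mul_of_pos_left (by omega) hn
      omega

end Greedy

/-! ### The expressions used in the enumeration -/

namespace RAM.LoopExpr

/-- The number of vertices. -/
def num : LoopExpr := tab 0 (const 0)

/-- The position of the entry `(a, b)` of an adjacency matrix. -/
def pos (a b : LoopExpr) : LoopExpr := op .add (op .mul num a) b

/-- The power of two that stands for the entry `(a, b)` of an adjacency matrix. -/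
def pow (a b : LoopExpr) : LoopExpr := tab 2 (pos a b)

/-- The entry `(a, b)` of the adjacency matrix with code `h`. -/
def bit (h a b : LoopExpr) : LoopExpr := op .mod (op .div h (pow a b)) (const 2)

def neg (a : LoopExpr) : LoopExpr := op .sub (const 1) a

def conj (a b : LoopExpr) : LoopExpr := op .mul a b

def disj (a b : LoopExpr) : LoopExpr := op .lt (const 0) (op .add a b)

/-- `f` is nonzero for some vertex `l`. -/
def ex (l : ℕ) (f : LoopExpr) : LoopExpr :=
  fold l (const 0) (op .lt (const 0) (op .add (var (l + 1)) f))

/-- The code of the graph whose adjacency matrix has the entries `f`, as a function of the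
variables `l` and `l + 2`. -/
def code (l : ℕ) (f : LoopExpr) : LoopExpr :=
  fold l (const 0) (fold (l + 2) (var (l + 1))
    (op .add (var (l + 3)) (op .mul f (pow (var l) (var (l + 2))))))

/-- Whether the graph with code `var j` is a threshold graph. -/
def threshold (j : ℕ) : LoopExpr :=
  neg (ex 40 (ex 50 (ex 60 (ex 70
    (conj (bit (var j) (var 40) (var 50)) (conj (neg (bit (var j) (var 50) (var 60)))
      (conj (bit (var j) (var 60) (var 70)) (conj (neg (bit (var j) (var 70) (var 40)))
        (conj (neg (op .eq (var 50) (var 60))) (neg (op .eq (var 70) (var 40))))))))))))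

/-- `addEdge` for the edge between the vertices `25` and `27` and the graph with code `var 28`. -/
def addEdge (gb : LoopExpr → LoopExpr → LoopExpr) : LoopExpr :=
  bind 29 (op .add (op .add (var 28) (pow (var 25) (var 27))) (pow (var 27) (var 25)))
    (bind 30 (conj (conj (gb (var 25) (var 27)) (neg (bit (var 28) (var 25) (var 27))))
      (threshold 29)) (op .add (op .mul (var 30) (var 29)) (op .mul (neg (var 30)) (var 28))))

/-- `greedy` for the graph with code `var 10`. -/
def greedy (gb : LoopExpr → LoopExpr → LoopExpr) : LoopExpr :=
  fold 21 (var 10) (fold 23 (var 22) (fold 25 (var 24) (fold 27 (var 26) (addEdge gb))))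

/-- The code of the current graph. -/
def cur : LoopExpr := tab 5 (const 0)

/-- The vertices that determine the pivot graph. -/
def pivot₁ : LoopExpr := op .div (tab 6 (const 0)) num
def pivot₂ : LoopExpr := op .mod (tab 6 (const 0)) num

/-- The vertex `a` is a common neighbour of the two vertices. -/
def common (a : LoopExpr) : LoopExpr := conj (bit cur a pivot₁) (bit cur a pivot₂)

/-- Adjacency of the vertices `0` and `2` in the pivot graph. -/
def pivotAdj (gb : LoopExpr → LoopExpr → LoopExpr) : LoopExpr :=
  disj (conj (bit cur (var 0) (var 2)) (disj (common (var 0)) (common (var 2))))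
    (conj (gb (var 0) (var 2))
      (conj (disj (op .eq (var 0) pivot₁) (op .eq (var 2) pivot₁))
        (neg (ex 20 (conj (common (var 20))
          (neg (conj (bit cur (var 20) (var 0)) (bit cur (var 20) (var 2)))))))))

/-- The neighbour of the current graph. -/
def neighbor (gb : LoopExpr → LoopExpr → LoopExpr) : LoopExpr :=
  bind 10 (code 0 (pivotAdj gb))
    (op .add (op .mul (threshold 10) (greedy gb)) (op .mul (neg (threshold 10)) cur))

/-- The first graph. -/
def first (gb : LoopExpr → LoopExpr → LoopExpr) : LoopExpr := bind 10 (const 0) (greedy gb)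

/-- The entries of the adjacency matrix of the input. -/
def inputBit (a b : LoopExpr) : LoopExpr := tab 1 (pos a b)

/-- The entries of the adjacency matrix of the complement of the input. -/
def complInputBit (a b : LoopExpr) : LoopExpr := conj (neg (inputBit a b)) (neg (op .eq a b))

/-- The code of the complement of the current graph. -/
def complCur : LoopExpr :=
  code 0 (conj (neg (bit cur (var 0) (var 2))) (neg (op .eq (var 0) (var 2))))

theorem wf_first_input : (first inputBit).wf [] 0 = true := by decide
theorem wf_first_complInput : (first complInputBit).wf [] 0 = true := by decide
theorem wf_neighbor_input : (neighbor inputBit).wf [] 0 = true := by decide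
theorem wf_neighbor_complInput : (neighbor complInputBit).wf [] 0 = true := by decide
theorem wf_cur : cur.wf [] 0 = true := by decide
theorem wf_complCur : complCur.wf [] 0 = true := by decide

/-! ### The values of the expressions -/

section Eval

variable {n : ℕ} {A : ℕ → ℕ} {m : Memory}

theorem _root_.RAM.Tables.two_le (ht : Tables n A m) : 2 ≤ m 4 0 := by
  rw [ht.cap_eq]
  calc 2 = 2 ^ 1 := rfl
    _ ≤ _ := Nat.pow_le_pow_right (by norm_num) (by nlinarith)

theorem _root_.RAM.Tables.lt_of_lt (ht : Tables n A m) {x : ℕ} (hx : x < 2 ^ (n * n)) :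
    x < m 4 0 := by
  rw [ht.cap_eq]
  exact hx.trans_le (Nat.pow_le_pow_right (by norm_num) (by nlinarith))

theorem _root_.RAM.Tables.ind_lt (ht : Tables n A m) (p : Prop) : ind p < m 4 0 := by
  have := ht.two_le
  have := ind_le_one p
  omega

theorem eval_num (ht : Tables n A m) (env : ℕ → ℕ) : num.eval m env = n := ht.size_eq

theorem eval_pos (ht : Tables n A m) (env : ℕ → ℕ) (a b : LoopExpr) :
    (pos a b).eval m env = n * a.eval m env + b.eval m env := by
  simp [pos, eval, eval_num ht, BinOp.apply_add, BinOp.apply_mul]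

theorem eval_pow (ht : Tables n A m) {env : ℕ → ℕ} {a b : LoopExpr} {u v : Fin n}
    (ha : a.eval m env = u) (hb : b.eval m env = v) :
    (pow a b).eval m env = 2 ^ (n * (u : ℕ) + v) := by
  have := pos_lt u v
  rw [pow, eval, eval_pos ht, ha, hb, ht.pow_eq _ (by nlinarith)]

theorem eval_bit (ht : Tables n A m) {env : ℕ → ℕ} {h a b : LoopExpr} {H : SimpleGraph (Fin n)}
    {u v : Fin n} (hh : h.eval m env = graphCode H)
    (ha : a.eval m env = u) (hb : b.eval m env = v) :
    (bit h a b).eval m env = ind (H.Adj u v) := by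
  rw [← graphCode_div_mod]
  simp [bit, eval, eval_pow ht ha hb, hh, BinOp.apply_mod, BinOp.apply_div]

theorem eval_neg {env : ℕ → ℕ} {a : LoopExpr} {p : Prop} (ha : a.eval m env = ind p) :
    (neg a).eval m env = ind (¬ p) := by
  rw [neg, eval, ha, ← one_sub_ind]
  rfl

theorem eval_conj {env : ℕ → ℕ} {a b : LoopExpr} {p q : Prop} (ha : a.eval m env = ind p)
    (hb : b.eval m env = ind q) : (conj a b).eval m env = ind (p ∧ q) := by
  rw [conj, eval, ha, hb, ← ind_mul]
  rfl

theorem eval_disj {env : ℕ → ℕ} {a b : LoopExpr} {p q : Prop} (ha : a.eval m env = ind p)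
    (hb : b.eval m env = ind q) : (disj a b).eval m env = ind (p ∨ q) := by
  rw [disj, eval, eval, eval, ha, hb, ← ind_add_pos]
  rfl

theorem eval_eq {env : ℕ → ℕ} {a b : LoopExpr} {u v : Fin n} (ha : a.eval m env = u)
    (hb : b.eval m env = v) : (op .eq a b).eval m env = ind (u = v) := by
  rw [eval, ha, hb, BinOp.apply_eq]
  by_cases h : u = v
  · simp [h, ind]
  · simp [h, ind, Fin.val_ne_of_ne h]

theorem eval_ex (ht : Tables n A m) {env : ℕ → ℕ} {l : ℕ} {f : LoopExpr} {p : Fin n → Prop}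
    (hf : ∀ (u : Fin n) (x : ℕ), f.eval m
      (Function.update (Function.update env l u) (l + 1) x) = ind (p u)) :
    (ex l f).eval m env = ind (∃ u, p u) := by
  have hcap := ht.two_le
  have key : iter (fun i x => (op .lt (const 0) (op .add (var (l + 1)) f)).eval m
      (Function.update (Function.update env l i) (l + 1) x) % m 4 0) (0 % m 4 0) n =
      ind (∃ u : Fin n, (u : ℕ) < n ∧ p u) := by
    refine iter_induction (fun i x => x = ind (∃ u : Fin n, (u : ℕ) < i ∧ p u)) ?_ ?_
    · rw [Nat.zero_mod, ind_of_false (by simp)]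
    · rintro i hi _ rfl
      have := hf ⟨i, hi⟩ (ind (∃ u : Fin n, (u : ℕ) < i ∧ p u))
      simp only at this
      simp only [eval, this, Function.update_self, BinOp.apply_lt, BinOp.apply_add]
      rw [ind_add_pos, Nat.mod_eq_of_lt (ht.ind_lt _)]
      congr 1
      apply propext
      constructor
      · rintro (⟨u, h1, h2⟩ | h)
        exacts [⟨u, by omega, h2⟩, ⟨⟨i, hi⟩, by simp, h⟩]
      · rintro ⟨u, h1, h2⟩
        by_cases hu : (u : ℕ) = i
        · right
          subst hu
          exact h2
        · exact .inl ⟨u, by omega, h2⟩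
  rw [ex, eval, ht.size_eq]
  refine key.trans ?_
  simp

/-- The body of a fold adds correctly only below the modulus `c`. Partial sums never exceed the
final sum, so a bound for the latter suffices. -/
theorem iter_eq_add_sum {f : ℕ → ℕ → ℕ} {F : ℕ → ℕ} {N c : ℕ}
    (hf : ∀ i < N, ∀ y, y + F i < c → f i y = y + F i) {x : ℕ}
    (hx : x + ∑ i ∈ Finset.range N, F i < c) :
    iter f x N = x + ∑ i ∈ Finset.range N, F i := by
  induction N with
  | zero => rfl
  | succ N ih =>
    rw [Finset.sum_range_succ] at hx ⊢
    rw [iter, ih (fun i hi => hf i (by omega)) (by omega), hf N (by omega) _ (by omega)]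
    omega

theorem eval_code (ht : Tables n A m) {env : ℕ → ℕ} {l : ℕ} {f : LoopExpr}
    {H : SimpleGraph (Fin n)} (hf : ∀ (u v : Fin n) (x y : ℕ), f.eval m
      (Function.update (Function.update (Function.update (Function.update env l u) (l + 1) x)
        (l + 2) v) (l + 3) y) = ind (H.Adj u v)) :
    (code l f).eval m env = graphCode H := by
  let c : ℕ → ℕ → ℕ := fun u v =>
    if h : u < n ∧ v < n then ind (H.Adj ⟨u, h.1⟩ ⟨v, h.2⟩) * 2 ^ (n * u + v) else 0
  have hsum : graphCode H = ∑ u ∈ Finset.range n, ∑ v ∈ Finset.range n, c u v := by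
    rw [graphCode_eq_sum, Finset.sum_range]
    refine Finset.sum_congr rfl fun u _ => ?_
    rw [Finset.sum_range]
    refine Finset.sum_congr rfl fun v _ => ?_
    simp [c]
  have hlt := ht.lt_of_lt (graphCode_lt H)
  rw [code, eval, ht.size_eq]
  simp only [eval, ht.size_eq]
  -- Both loops are sums whose partial sums are at most `graphCode H`, hence below the cap.
  rw [iter_eq_add_sum (F := fun u => ∑ v ∈ Finset.range n, c u v) (c := m 4 0), hsum, Nat.zero_mod,
    zero_add]
  · intro u hu x hx
    have hx' : x < m 4 0 := by omega
    rw [iter_eq_add_sum (F := c u) (c := m 4 0)]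
    · rw [Function.update_self, Nat.mod_eq_of_lt hx', Nat.mod_eq_of_lt hx]
    · intro v hv y hy
      have := hf ⟨u, hu⟩ ⟨v, hv⟩ x y
      simp only at this
      rw [this, eval_pow ht (u := ⟨u, hu⟩) (v := ⟨v, hv⟩)]
      · have hc : c u v = ind (H.Adj ⟨u, hu⟩ ⟨v, hv⟩) * 2 ^ (n * u + v) := by simp [c, hu, hv]
        rw [hc] at hy ⊢
        simp only [Function.update_self, BinOp.apply_add, BinOp.apply_mul]
        exact Nat.mod_eq_of_lt hy
      · rw [eval, Function.update_of_ne (by omega), Function.update_of_ne (by omega),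
          Function.update_of_ne (by omega), Function.update_self]
      · simp [eval]
    · rwa [Function.update_self, Nat.mod_eq_of_lt hx']
  · rwa [Nat.zero_mod, zero_add, ← hsum]

/-- The assumption `j < 40` keeps the variable `j` apart from the four quantified vertices, which
use the variables from `40` on. -/
theorem eval_threshold (ht : Tables n A m) {env : ℕ → ℕ} {j : ℕ} (hj : j < 40)
    {H : SimpleGraph (Fin n)} (h : env j = graphCode H) :
    (threshold j).eval m env = ind (IsThreshold H) := by
  have hne : ∀ k, 40 ≤ k → j ≠ k := fun k hk => by omega
  have key : (threshold j).eval m env = ind (¬ ∃ a b c d, H.Adj a b ∧ ¬ H.Adj b c ∧ H.Adj c d ∧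
      ¬ H.Adj d a ∧ ¬ b = c ∧ ¬ d = a) := by
    refine eval_neg (eval_ex ht fun a _ => eval_ex ht fun b _ => eval_ex ht fun c _ =>
      eval_ex ht fun d _ => ?_)
    refine eval_conj (eval_bit ht ?_ ?_ ?_) (eval_conj (eval_neg (eval_bit ht ?_ ?_ ?_))
      (eval_conj (eval_bit ht ?_ ?_ ?_) (eval_conj (eval_neg (eval_bit ht ?_ ?_ ?_))
        (eval_conj (eval_neg (eval_eq ?_ ?_)) (eval_neg (eval_eq ?_ ?_)))))) <;>
    simp [eval, hne, h]
  rw [key]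
  congr 1
  rw [isThreshold_iff]
  apply propext
  push Not
  exact ⟨fun h a b c d h1 h2 h3 h4 h5 h6 => h6 (h a b c d h1 h2 h3 h4 h5),
    fun h a b c d h1 h2 h3 h4 h5 => by_contra fun h6 => h a b c d h1 h2 h3 h4 h5 h6⟩

/-- `gb a b` tells whether `a` and `b` are adjacent in `G`. -/
def Represents (m : Memory) (gb : LoopExpr → LoopExpr → LoopExpr) (G : SimpleGraph (Fin n)) :
    Prop :=
  ∀ (env : ℕ → ℕ) (a b : LoopExpr) (u v : Fin n), a.eval m env = u → b.eval m env = v →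
    (gb a b).eval m env = ind (G.Adj u v)

variable {gb : LoopExpr → LoopExpr → LoopExpr} {G : SimpleGraph (Fin n)}

theorem eval_addEdge (ht : Tables n A m) (hgb : Represents m gb G) {env : ℕ → ℕ} {u v : Fin n}
    {H : SimpleGraph (Fin n)} (hu : env 25 = u) (hv : env 27 = v) (hH : env 28 = graphCode H) :
    (addEdge gb).eval m env = graphCode (_root_.addEdge G u v H) := by
  set x := (graphCode H + 2 ^ (n * (u : ℕ) + v) + 2 ^ (n * (v : ℕ) + u)) % m 4 0 with hx
  have h29 : (op .add (op .add (var 28) (pow (var 25) (var 27))) (pow (var 27) (var 25))).eval m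
      env % m 4 0 = x := by
    rw [eval, eval, eval_pow ht (a := var 25) (b := var 27) hu hv,
      eval_pow ht (a := var 27) (b := var 25) hv hu, hx, ← hH]
    rfl
  rw [addEdge, eval, h29, eval]
  set env' := Function.update env 29 x with henv'
  have hu' : env' 25 = u := by simp [henv', hu]
  have hv' : env' 27 = v := by simp [henv', hv]
  have hH' : env' 28 = graphCode H := by simp [henv', hH]
  have hx' : env' 29 = x := by simp [henv']
  have hc : (conj (gb (var 25) (var 27)) (neg (bit (var 28) (var 25) (var 27)))).eval m env' =
      ind (G.Adj u v ∧ ¬ H.Adj u v) :=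
    eval_conj (hgb _ _ _ _ _ hu' hv') (eval_neg (eval_bit ht hH' hu' hv'))
  have h30 : (conj (conj (gb (var 25) (var 27)) (neg (bit (var 28) (var 25) (var 27))))
      (threshold 29)).eval m env' =
      ind (G.Adj u v ∧ ¬ H.Adj u v ∧ IsThreshold (H ⊔ SimpleGraph.edge u v)) := by
    -- If `uv` is not an edge of `G` or is already in `H`, variable `29` need not be the code of the
    -- enlarged graph and the threshold test is meaningless; the other factor of the product is then
    -- zero.
    by_cases h : G.Adj u v ∧ ¬ H.Adj u v
    · have hx'' : env' 29 = graphCode (H ⊔ SimpleGraph.edge u v) := by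
        rw [hx', hx, ← graphCode_sup_edge h.1.ne h.2,
          Nat.mod_eq_of_lt (ht.lt_of_lt (graphCode_lt _))]
      rw [eval_conj hc (eval_threshold ht (by norm_num) hx''), and_assoc]
    · rw [conj, eval, hc, ind_of_false h, ind_of_false (fun h' => h ⟨h'.1, h'.2.1⟩),
        BinOp.apply_mul, zero_mul]
  rw [h30, Nat.mod_eq_of_lt (ht.ind_lt _)]
  unfold _root_.addEdge
  split_ifs with h
  · rw [ind_of_true h, graphCode_sup_edge h.1.ne h.2.1]
    simp only [neg, eval, BinOp.apply_add, BinOp.apply_mul, BinOp.apply_sub]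
    simp only [Function.update_apply, hx', hH']
    simp only [hx]
    rw [← graphCode_sup_edge h.1.ne h.2.1, Nat.mod_eq_of_lt (ht.lt_of_lt (graphCode_lt _))]
    simp
  · rw [ind_of_false h]
    simp only [neg, eval, BinOp.apply_add, BinOp.apply_mul, BinOp.apply_sub]
    simp [hH']

theorem iter_graphCode {f : ℕ → ℕ → ℕ} {F : ℕ → SimpleGraph (Fin n) → SimpleGraph (Fin n)} {N : ℕ}
    (h : ∀ i < N, ∀ K, f i (graphCode K) = graphCode (F i K)) (H : SimpleGraph (Fin n)) :
    iter f (graphCode H) N = graphCode (iter F H N) := by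
  induction N with
  | zero => rfl
  | succ N ih => rw [iter, iter, ih fun i hi => h i (by omega), h N (by omega)]

theorem eval_fold (ht : Tables n A m) {env : ℕ → ℕ} {l : ℕ} {init body : LoopExpr}
    {H : SimpleGraph (Fin n)} {F : ℕ → SimpleGraph (Fin n) → SimpleGraph (Fin n)}
    (hinit : init.eval m env = graphCode H)
    (hbody : ∀ i < n, ∀ K, body.eval m
      (Function.update (Function.update env l i) (l + 1) (graphCode K)) = graphCode (F i K)) :
    (fold l init body).eval m env = graphCode (iter F H n) := by
  rw [eval, ht.size_eq, hinit, Nat.mod_eq_of_lt (ht.lt_of_lt (graphCode_lt _))]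
  refine iter_graphCode (fun i hi K => ?_) H
  rw [hbody i hi K, Nat.mod_eq_of_lt (ht.lt_of_lt (graphCode_lt _))]

theorem eval_greedy (ht : Tables n A m) (hgb : Represents m gb G) {env : ℕ → ℕ}
    {H : SimpleGraph (Fin n)} (hH : env 10 = graphCode H) :
    (greedy gb).eval m env = graphCode (_root_.greedy G H) := by
  refine eval_fold ht hH fun _ _ K₁ => eval_fold ht (by simp [eval]) fun _ _ K₂ =>
    eval_fold ht (by simp [eval]) fun u hu K₃ => eval_fold ht (by simp [eval]) fun v hv K₄ => ?_
  rw [dif_pos ⟨hu, hv⟩]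
  apply eval_addEdge ht hgb <;> simp

theorem eval_first (ht : Tables n A m) (hgb : Represents m gb G) (env : ℕ → ℕ) :
    (first gb).eval m env = graphCode (_root_.greedy G ⊥) := by
  rw [first, eval]
  exact eval_greedy ht hgb (by simp [eval, graphCode_bot])

theorem eval_pivotAdj (ht : Tables n A m) (hgb : Represents m gb G) {env : ℕ → ℕ}
    {S : SimpleGraph (Fin n)} {c x u v : Fin n} (hS : m 5 0 = graphCode S)
    (hc : m 6 0 / n = c) (hx : m 6 0 % n = x) (hu : env 0 = u) (hv : env 2 = v) :
    (pivotAdj gb).eval m env = ind ((pivotGraph G S c x).Adj u v) := by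
  have hc' : ∀ env, pivot₁.eval m env = c := fun env => by
    rw [pivot₁, eval, eval_num ht, ← hc]; rfl
  have hx' : ∀ env, pivot₂.eval m env = x := fun env => by
    rw [pivot₂, eval, eval_num ht, ← hx]; rfl
  have hS' : ∀ env, cur.eval m env = graphCode S := fun env => hS
  have hcom : ∀ (env : ℕ → ℕ) (a : LoopExpr) (w : Fin n), a.eval m env = w →
      (common a).eval m env = ind (S.Adj w c ∧ S.Adj w x) := fun env a w hw =>
    eval_conj (eval_bit ht (hS' _) hw (hc' _)) (eval_bit ht (hS' _) hw (hx' _))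
  have key := eval_disj (eval_conj (eval_bit ht (hS' env) (a := var 0) (b := var 2) hu hv)
    (eval_disj (hcom env (var 0) u hu) (hcom env (var 2) v hv)))
    (eval_conj (hgb env (var 0) (var 2) u v hu hv)
      (eval_conj (eval_disj (eval_eq (a := var 0) hu (hc' env)) (eval_eq (a := var 2) hv (hc' env)))
        (eval_neg (eval_ex ht (l := 20) fun w y => eval_conj
          (hcom (Function.update (Function.update env 20 w) (20 + 1) y) (var 20) w
            (by simp [eval]))
          (eval_neg (eval_conj (eval_bit ht (hS' _) (a := var 20) (b := var 0) (u := w) (v := u)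
            (by simp [eval]) (by simp [eval, hu]))
            (eval_bit ht (hS' _) (a := var 20) (b := var 2) (u := w) (v := v) (by simp [eval])
              (by simp [eval, hv]))))))))
  refine key.trans ?_
  congr 1
  apply propext
  simp only [pivotGraph, not_exists, not_and_not_right]

open Classical in
/-- The neighbour number `k` of the graph with code `x`. -/
noncomputable def neighborCode (G : SimpleGraph (Fin n)) (x k : ℕ) : ℕ :=
  if h : k < n * n then
    let K := pivotGraph G (Function.invFun graphCode x) ⟨k / n, Nat.div_lt_of_lt_mul h⟩
      ⟨k % n, Nat.mod_lt _ (Nat.pos_of_lt_mul_left h)⟩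
    if IsThreshold K then graphCode (_root_.greedy G K) else x
  else x

theorem invFun_graphCode (H : SimpleGraph (Fin n)) :
    Function.invFun graphCode (graphCode H) = H :=
  Function.leftInverse_invFun (graphCode_injective n) H

theorem eval_neighbor (ht : Tables n A m) (hgb : Represents m gb G) (env : ℕ → ℕ)
    {S : SimpleGraph (Fin n)} (hS : m 5 0 = graphCode S) (hk : m 6 0 < n * n) :
    (neighbor gb).eval m env = neighborCode G (m 5 0) (m 6 0) := by
  rw [neighborCode, dif_pos hk, hS, invFun_graphCode]
  set K := pivotGraph G S ⟨m 6 0 / n, Nat.div_lt_of_lt_mul hk⟩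
      ⟨m 6 0 % n, Nat.mod_lt _ (Nat.pos_of_lt_mul_left hk)⟩ with hK
  have hcode : (code 0 (pivotAdj gb)).eval m env = graphCode K := by
    refine eval_code ht fun u v x y => eval_pivotAdj ht hgb hS rfl rfl ?_ ?_ <;>
    simp
  rw [neighbor, eval, hcode, Nat.mod_eq_of_lt (ht.lt_of_lt (graphCode_lt _))]
  have h10 : Function.update env 10 (graphCode K) 10 = graphCode K := by simp
  have hcur : ∀ env, cur.eval m env = graphCode S := fun _ => hS
  rw [eval, eval, eval, eval_threshold ht (by norm_num) h10, eval_greedy ht hgb h10,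
    eval_neg (eval_threshold ht (by norm_num) h10), hcur]
  simp only [BinOp.apply_add, BinOp.apply_mul]
  split_ifs with h
  · rw [ind_of_true h, ind_of_false (not_not.2 h)]
    simp
  · rw [ind_of_false h, ind_of_true h]
    simp

/-- The output map `o` is left open: the same traversal serves completions, where each node is
output as the complement of the graph it codes. -/
theorem traversalSpec (hgb : ∀ m, Tables n A m → Represents m gb G) {out : LoopExpr} {o : ℕ → ℕ}
    (ho : ∀ m env (S : SimpleGraph (Fin n)), Tables n A m → m 5 0 = graphCode S →
      out.eval m env = o (m 5 0))
    (ho' : ∀ S : SimpleGraph (Fin n), o (graphCode S) < 2 ^ (n * n)) :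
    TraversalSpec (first gb) (neighbor gb) out n A (graphCode '' minimalThresholdDeletions G)
      (graphCode (_root_.greedy G ⊥)) (neighborCode G) o where
  start_eq m env ht := eval_first ht (hgb m ht) env
  next_eq := by
    rintro m env ht ⟨S, -, hS⟩ hk
    exact eval_neighbor ht (hgb m ht) env hS.symm hk
  out_eq := by
    rintro m env ht ⟨S, -, hS⟩
    exact ho m env S ht hS.symm
  start_mem := ⟨_, (greedy_spec bot_le isThreshold_bot).2, rfl⟩
  next_mem := by
    rintro _ ⟨S, hS, rfl⟩ k hk
    rw [neighborCode, dif_pos hk, invFun_graphCode]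
    simp only
    split_ifs with h
    · exact ⟨_, (greedy_spec (pivotGraph_le hS.1.1 _ _) h).2, rfl⟩
    · exact ⟨S, hS, rfl⟩
  lt := by
    rintro _ ⟨S, -, rfl⟩
    exact graphCode_lt S
  out_lt := by
    rintro _ ⟨S, -, rfl⟩
    exact ho' S

/-- Transfers `mem_of_pivotGraph_closed` to codes. The pair `(c, x)` is the neighbour number `n * c
+ x`, recovered by division with remainder. -/
theorem mem_of_neighborCode_closed {C : Set ℕ}
    (hC : C ⊆ graphCode '' minimalThresholdDeletions G) (hs : graphCode (_root_.greedy G ⊥) ∈ C)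
    (hcl : ∀ x ∈ C, ∀ k < n * n, neighborCode G x k ∈ C) {H : SimpleGraph (Fin n)}
    (hH : H ∈ minimalThresholdDeletions G) : graphCode H ∈ C := by
  have hmem : ∀ S, graphCode S ∈ C → S ∈ minimalThresholdDeletions G := by
    intro S hS
    obtain ⟨S', hS', heq⟩ := hC hS
    rwa [← graphCode_injective n heq]
  refine mem_of_pivotGraph_closed (C := {S | graphCode S ∈ C}) hmem ⟨_, hs⟩ ?_ hH
  intro S hS c x ht
  have hk := pos_lt c x
  have hn := Nat.pos_of_lt_mul_left hk
  have h := hcl _ hS (n * c + x) hk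
  have hc : (⟨(n * (c : ℕ) + x) / n, Nat.div_lt_of_lt_mul hk⟩ : Fin n) = c := by
    apply Fin.ext
    simp only
    rw [Nat.mul_add_div hn, Nat.div_eq_of_lt x.isLt, add_zero]
  have hx : (⟨(n * (c : ℕ) + x) % n, Nat.mod_lt _ hn⟩ : Fin n) = x := by
    apply Fin.ext
    simp only
    rw [Nat.mul_add_mod, Nat.mod_eq_of_lt x.isLt]
  rw [neighborCode, dif_pos hk, invFun_graphCode, hc, hx] at h
  simp only [if_pos ht] at h
  exact ⟨_, h, (greedy_spec (pivotGraph_le (hmem S hS).1.1 c x) ht).1⟩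

/-! ### The input graph and its complement -/

theorem represents_inputBit (ht : Tables n (graphInput G 1) m) : Represents m inputBit G := by
  intro env a b u v ha hb
  rw [inputBit, eval, eval_pos ht, ha, hb, ht.input_eq]
  unfold graphInput
  simp only [one_ne_zero, false_and, if_false, true_and]
  by_cases h : G.Adj u v
  · rw [ind_of_true h, if_pos ⟨rfl, u, v, rfl, h⟩]
  · rw [ind_of_false h, if_neg]
    rintro ⟨-, i, j, hij, hadj⟩
    have := pos_injective (a₁ := (u, v)) (a₂ := (i, j)) hij
    simp only [Prod.mk.injEq] at this
    rw [this.1, this.2] at h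
    exact h hadj

theorem represents_complInputBit (ht : Tables n (graphInput G 1) m) :
    Represents m complInputBit Gᶜ := by
  intro env a b u v ha hb
  rw [complInputBit, eval_conj (eval_neg (represents_inputBit ht env a b u v ha hb))
    (eval_neg (eval_eq ha hb)), SimpleGraph.compl_adj, and_comm]

theorem eval_complCur (ht : Tables n A m) (env : ℕ → ℕ) {S : SimpleGraph (Fin n)}
    (hS : m 5 0 = graphCode S) : complCur.eval m env = graphCode Sᶜ := by
  refine eval_code ht fun u v x y => ?_
  rw [SimpleGraph.compl_adj, and_comm]
  refine eval_conj (eval_neg (eval_bit ht hS ?_ ?_)) (eval_neg (eval_eq ?_ ?_)) <;>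
  simp [eval]

end Eval

end RAM.LoopExpr

open RAM.LoopExpr in
theorem mainTheorem7 :
    EnumerableWithPolyDelayExpSpace (fun {_} G => minimalThresholdDeletions G) ∧
    EnumerableWithPolyDelayExpSpace (fun {_} G => minimalThresholdCompletions G) := by
  refine ⟨enumerable_of_traversal wf_first_input wf_neighbor_input wf_cur fun n G =>
      ⟨graphCode '' minimalThresholdDeletions G, _, neighborCode G, Function.invFun graphCode,
        traversalSpec (fun m ht => represents_inputBit ht) ?_ ?_, ?_, ?_, ?_⟩,
    -- For completions the nodes are the minimal deletions of `Gᶜ`, and complements are output.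
    enumerable_of_traversal wf_first_complInput wf_neighbor_complInput wf_complCur fun n G =>
      ⟨graphCode '' minimalThresholdDeletions Gᶜ, _, neighborCode Gᶜ,
        fun x => (Function.invFun graphCode x)ᶜ,
        traversalSpec (fun m ht => represents_complInputBit ht) ?_ ?_, ?_, ?_, ?_⟩⟩
  · intro m env S _ hS
    rw [hS, invFun_graphCode]
    exact hS
  · intro S
    exact graphCode_lt _
  · rintro _ ⟨S, hS, rfl⟩
    rwa [invFun_graphCode]
  · rintro _ ⟨S, -, rfl⟩ _ ⟨T, -, rfl⟩ h
    rw [invFun_graphCode, invFun_graphCode] at h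
    rw [h]
  · intro C' hC' hs hcl H hH
    exact ⟨_, mem_of_neighborCode_closed hC' hs hcl hH, invFun_graphCode H⟩
  · intro m env S ht hS
    rw [eval_complCur ht env hS, hS]
    simp only [invFun_graphCode]
  · intro S
    exact graphCode_lt _
  · rintro _ ⟨S, hS, rfl⟩
    simp only [invFun_graphCode]
    rw [mem_minimalThresholdCompletions_iff, compl_compl]
    exact hS
  · rintro _ ⟨S, -, rfl⟩ _ ⟨T, -, rfl⟩ h
    simp only [invFun_graphCode] at h
    rw [compl_injective h]
  · intro C' hC' hs hcl H hH
    refine ⟨graphCode Hᶜ, mem_of_neighborCode_closed hC' hs hcl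
      (mem_minimalThresholdCompletions_iff.1 hH), ?_⟩
    simp only [invFun_graphCode, compl_compl]
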